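/- **Comparison functions.** $\mathcal P$ is the set of continuous $\alpha:[0,\infty)\to[0,\infty)$ with $\alpha(0)=0$ and $\alpha(r)>0$ for $r>0$; $\mathcal K$ is the set of continuous strictly increasing $\alpha:[0,\infty)\to[0,\infty)$ with $\alpha(0)=0$; $\mathcal K_\infty$ is the set of unbounded functions in $\mathcal K$. A *nonlinear scaling* is a $\xi\in\mathcal K_\infty$ that is $C^1$ on $(0,\infty)$ with $\xi'>0$ there and for which $\lim_{s\to0^+}\xi'(s)$ exists and is finite. Let $\ell_\infty$ be the space of bounded real sequences with the sup norm, $\ell_\infty^+$ its cone of componentwise nonnegative sequences, ordered componentwise. A *monotone homogeneous aggregation function* is a map $\mu:\ell_\infty^+\to[0,\infty]$ with $\mu(cs)=c\mu(s)$ for $c\ge0$ (where $0\cdot\infty=0$), $\mu(r)\le\mu(s)$ whenever $r\le s$, and $\mu(r+s)\le\mu(r)+\mu(s)$. **Network.** For $i\in\mathbb N$ let $n_i,m_i$ be positive integers, fix norms $|\cdot|$ on $\mathbb R^{n_i}$ and $\mathbb R^{m_i}$, let $I_i\subset\mathbb N\setminus\{i\}$ be finite and $f_i:\mathbb R^{n_i}\times\prod_{j\in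 I_i}\mathbb R^{n_j}\times\mathbb R^{m_i}\to\mathbb R^{n_i}$ continuous. Assume that for every $i$, every initial state and all essentially bounded inputs $\bar x_i(\cdot),u_i(\cdot)$ the equation $\dot x_i=f_i(x_i,\bar x_i,u_i)$ has a unique local solution. Let $X$ and $U$ be the Banach spaces of bounded sequences $x=(x_i)$, $x_i\in\mathbb R^{n_i}$, and $u=(u_i)$, $u_i\in\mathbb R^{m_i}$, with norms $\|x\|_X=\sup_i|x_i|$ and $\|u\|_U=\sup_i|u_i|$. Put $f(x,u)=(f_i(x_i,\bar x_i,u_i))_i$ with $\bar x_i=(x_j)_{j\in I_i}$. Let $\mathcal U$ be the set of $u\in L_\infty([0,\infty),U)$ for which there are $0=a_0<a_1<\cdots\to\infty$ such that $u$ is continuous on each $[a_n,a_{n+1})$, with norm $\|u\|_{\mathcal U}=\operatorname{ess\,sup}_t\|u(t)\|_U$. A solution on $[0,T)$, $0<T\le\infty$, of $$\Sigma:\quad\dot x=f(x,u),\qquad x(0)=x^0\in X,\quad u\in\mathcal U,$$ is a function $\varphi:[0,T)\to X$ such that $s\mapsto f(\varphi(s),u(s))$ is $X$-valued and locally Bochner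 integrable and $\varphi(t)=x^0+\int_0^tf(\varphi(s),u(s))\,ds$ on $[0,T)$. $\Sigma$ is *well-posed* if for all $x^0\in X$, $u\in\mathcal U$ a local solution exists and any two solutions agree on their common interval; write $\phi(t,x^0,u)$ for the solution. $\Sigma$ has the *BIC property* if every bounded solution on $[0,T)$ with $T<\infty$ extends to a solution on a larger interval. **ISS Lyapunov functions.** For $V:X\to[0,\infty)$ put $\mathrm D^+V_u(x)=\limsup_{t\to0^+}\frac{V(\phi(t,x,u))-V(x)}t$. Let $V$ be continuous with $\psi_1(\|x\|_X)\le V(x)\le\psi_2(\|x\|_X)$ for some $\psi_1,\psi_2\in\mathcal K_\infty$ and all $x\in X$. Then $V$ is an *ISS Lyapunov function in implication form* if there are $\gamma\in\mathcal K$, $\alpha\in\mathcal P$ such that for all $x\in X$, $u\in\mathcal U$: $V(x)>\gamma(\|u\|_{\mathcal U})$ implies $\mathrm D^+V_u(x)\le-\alpha(V(x))$. It is an *ISS Lyapunov function in dissipative form* if there are $\alpha\in\mathcal K_\infty$, $\rho\in\mathcal K$ such that $\mathrm D^+V_u(x)\le-\alpha(V(x))+\rho(\|u\|_{\mathcal U})$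 for all $x\in X$, $u\in\mathcal U$. **Hypotheses.** 1. $\Sigma$ is well-posed and has the BIC property. 2. For each $i$ there is a continuous $V_i:\mathbb R^{n_i}\to[0,\infty)$, $C^1$ outside $0$, and there are $\psi_{i1},\psi_{i2}\in\mathcal K_\infty$, a monotone homogeneous aggregation function $\mu_i$, gains $\gamma_{ij}\ge0$ with $\gamma_{ij}=0$ for $j\notin I_i$, $\gamma_{iu}\in\mathcal K$ and $\alpha_i\in\mathcal P$ with $\psi_{i1}(|x_i|)\le V_i(x_i)\le\psi_{i2}(|x_i|)$ for all $x_i$, and for all $x\in X$, $u\in U$ $$V_i(x_i)>\max\{\mu_i((\gamma_{ij}V_j(x_j))_{j}),\gamma_{iu}(|u_i|)\}\ \Rightarrow\ \nabla V_i(x_i)f_i(x_i,\bar x_i,u_i)\le-\alpha_i(V_i(x_i)).$$ Moreover, there are $\psi_1,\psi_2\in\mathcal K_\infty$ with $\psi_1\le\psi_{i1}$ and $\psi_{i2}\le\psi_2$ for all $i$. 3. The gain operator $\Gamma(s)=(\mu_i((\gamma_{ij}s_j)_j))_i$ is well-defined as a map $\ell_\infty^+\to\ell_\infty^+$ (equivalently,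 $\sup_i\mu_i((\gamma_{ij})_j)<\infty$), and there is $\gamma^u_{\max}\in\mathcal K$ with $\gamma_{iu}\le\gamma^u_{\max}$ for all $i$. 4. $r(\Gamma):=\lim_{n\to\infty}\sup_{\|s\|=1}\|\Gamma^n(s)\|^{1/n}<1$. 5. For every $R>0$ there is $L(R)>0$ with $|V_i(y)-V_i(z)|\le L(R)|y-z|$ for all $i$ and all $y,z\in\mathbb R^{n_i}$ with $|y|,|z|<R$. 6. There is $\tilde\alpha\in\mathcal P$ with $\alpha_i\ge\tilde\alpha$ for all $i$. 7. $f$ maps $X\times U$ continuously into $X$, and $\sup\{\|f(x,u)\|_X:\|x\|_X\le R,\|u\|_U\le R\}<\infty$ for every $R>0$. 8. The $V_i$ are continuously differentiable at the origin, and the constants $L(R)$ in 5 can be chosen as a continuous function of $R>0$ with $L(R)\to0$ as $R\to0$. **Conclusion.** For $s^0\in\operatorname{int}(\ell_\infty^+)$ put $V_{s^0}(x):=\sup_i\frac1{s^0_i}V_i(x_i)$, $x\in X$. There is an $s^0\in\operatorname{int}(\ell_\infty^+)$ for which $V_{s^0}$ is an ISS Lyapunov function for $\Sigma$ in implication form,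 and for every such $s^0$ there is a nonlinear scaling $\xi\in\mathcal K_\infty$ such that $W=\xi\circ V_{s^0}$ is an ISS Lyapunov function for $\Sigma$ in dissipative form. -/

import Mathlib

open Set Filter Topology MeasureTheory
open scoped ENNReal NNReal

namespace InfNet

/-! ### Comparison functions

Comparison functions are represented by functions `ℝ → ℝ` of which only the restriction to
`[0, ∞)` matters. -/

/-- Positive definite functions on `[0, ∞)`. -/
structure ClassP (α : ℝ → ℝ) : Prop where
  cont : ContinuousOn α (Ici 0)
  zero : α 0 = 0
  pos : ∀ r, 0 < r → 0 < α r

/-- Class `K` functions on `[0, ∞)`. -/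
structure ClassK (α : ℝ → ℝ) : Prop where
  cont : ContinuousOn α (Ici 0)
  zero : α 0 = 0
  strictMono : StrictMonoOn α (Ici 0)

/-- Class `K∞` functions on `[0, ∞)`. -/
structure ClassKInf (α : ℝ → ℝ) : Prop extends ClassK α where
  unbounded : Tendsto α atTop atTop

/-- Nonlinear scalings: class `K∞` functions that are continuously differentiable with positive
derivative on `(0, ∞)` and whose derivative has a finite limit at `0`. -/
structure IsNonlinearScaling (ξ : ℝ → ℝ) : Prop extends ClassKInf ξ where
  contDiff : ContDiffOn ℝ 1 ξ (Ioi 0)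
  deriv_pos : ∀ s, 0 < s → 0 < deriv ξ s
  deriv_lim : ∃ l : ℝ, Tendsto (deriv ξ) (𝓝[>] 0) (𝓝 l)

/-! ### The positive cone of `ℓ∞`, aggregation functions and gain operators -/

/-- The Banach space of bounded real sequences. -/
abbrev EllInf : Type := lp (fun _ : ℕ => ℝ) ∞

/-- The positive cone of `ℓ∞`. -/
def posCone : Submodule ℝ≥0 EllInf where
  carrier := {s | ∀ i, 0 ≤ s i}
  add_mem' {a b} ha hb i := by
    have h : (a + b : EllInf) i = a i + b i := rfl
    rw [h]
    exact add_nonneg (ha i) (hb i)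
  zero_mem' i := le_refl (0 : ℝ)
  smul_mem' c a ha i := by
    have h : (c • a : EllInf) i = (c : ℝ) * a i := rfl
    rw [h]
    exact mul_nonneg c.2 (ha i)

noncomputable instance : SMul ℝ≥0 posCone := ⟨fun c s => ⟨c • s.1, posCone.smul_mem c s.2⟩⟩

/-- Monotone, homogeneous aggregation functions. -/
structure IsMHAF (μ : posCone → ℝ≥0∞) : Prop where
  homogeneous : ∀ (c : ℝ≥0) (s : posCone), μ (c • s) = (c : ℝ≥0∞) * μ s
  monotone : ∀ r s : posCone, (∀ j, r.1 j ≤ s.1 j) → μ r ≤ μ s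
  subadditive : ∀ r s : posCone, μ (r + s) ≤ μ r + μ s

theorem memlp_gainRow (g : ℕ →₀ ℝ≥0) (v : ℕ → ℝ≥0) :
    Memℓp (fun j => ((g j * v j : ℝ≥0) : ℝ)) ∞ := by
  refine memℓp_infty ?_
  refine ((g.support.finite_toSet.image (fun j => ‖((g j * v j : ℝ≥0) : ℝ)‖)).insert 0).bddAbove.mono
    ?_
  rintro _ ⟨j, rfl⟩
  by_cases h : j ∈ g.support
  · exact Or.inr ⟨j, h, rfl⟩
  · left
    have h0 : g j = 0 := by simpa using h
    simp [h0]

/-- The sequence `(g j * v j)_j`, for a row `g` of gains with finitely many nonzero entries. -/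
def gainRow (g : ℕ →₀ ℝ≥0) (v : ℕ → ℝ≥0) : posCone :=
  ⟨⟨fun j => ((g j * v j : ℝ≥0) : ℝ), memlp_gainRow g v⟩, fun j => (g j * v j).2⟩

/-- The `i`-th component of `Γ_μ(s)`, as an extended nonnegative number. -/
noncomputable def gainComp (μ : ℕ → posCone → ℝ≥0∞) (γ : ℕ → ℕ →₀ ℝ≥0) (s : posCone) (i : ℕ) :
    ℝ≥0∞ :=
  μ i (gainRow (γ i) (fun j => ⟨s.1 j, s.2 j⟩))

/-- The gain operator is well-defined: it maps the positive cone of `ℓ∞` into itself. -/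
def GainWellDefined (μ : ℕ → posCone → ℝ≥0∞) (γ : ℕ → ℕ →₀ ℝ≥0) : Prop :=
  ∀ s : posCone, ∃ C : ℝ≥0, ∀ i, gainComp μ γ s i ≤ C

theorem memlp_gainOp (μ : ℕ → posCone → ℝ≥0∞) (γ : ℕ → ℕ →₀ ℝ≥0) (h : GainWellDefined μ γ)
    (s : posCone) : Memℓp (fun i => (gainComp μ γ s i).toReal) ∞ := by
  obtain ⟨C, hC⟩ := h s
  refine memℓp_infty ⟨C, ?_⟩
  rintro _ ⟨i, rfl⟩
  have h1 := ENNReal.toReal_mono ENNReal.coe_ne_top (hC i)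
  simpa using h1

/-- The gain operator `Γ_μ`. -/
noncomputable def gainOp (μ : ℕ → posCone → ℝ≥0∞) (γ : ℕ → ℕ →₀ ℝ≥0)
    (h : GainWellDefined μ γ) (s : posCone) : posCone :=
  ⟨⟨fun i => (gainComp μ γ s i).toReal, memlp_gainOp μ γ h s⟩, fun _ => ENNReal.toReal_nonneg⟩

/-- `r` is the spectral radius of `Γ`, i.e.
`r = lim_{n → ∞} sup_{‖s‖ = 1} ‖Γ^n(s)‖^{1/n}` (suprema and limit in `[0, ∞]`). -/
def HasSpectralRadius (Γ : posCone → posCone) (r : ℝ≥0∞) : Prop :=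
  Tendsto (fun n : ℕ => ⨆ s : {s : posCone // ‖(s : EllInf)‖ = 1},
    ‖((Γ^[n] s.1 : posCone) : EllInf)‖ₑ ^ (1 / (n : ℝ))) atTop (𝓝 r)

/-! ### Networks

The state space `ℝ^{n_i}` and the input space `ℝ^{m_i}` of the `i`-th subsystem, each with an
arbitrary norm, are the finite-dimensional normed spaces `E i` and `F i`; the state space
`X` and the input space `U` of the network are `lp E ∞` and `lp F ∞`. -/

universe u v

/-- Time interval `[0, T)`, where `T = ⊤` is allowed. -/
def timeIco (T : EReal) : Set ℝ := {t | 0 ≤ t ∧ (t : EReal) < T}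

section Net

variable {E : ℕ → Type u} {F : ℕ → Type v}
  [∀ i, NormedAddCommGroup (E i)] [∀ i, NormedSpace ℝ (E i)]
  [∀ i, NormedAddCommGroup (F i)] [∀ i, NormedSpace ℝ (F i)]

/-- The data of a network: finite sets of neighbors and continuous right-hand sides. -/
structure Network (E : ℕ → Type u) (F : ℕ → Type v)
    [∀ i, NormedAddCommGroup (E i)] [∀ i, NormedAddCommGroup (F i)] where
  nbr : ℕ → Finset ℕ
  not_mem_nbr : ∀ i, i ∉ nbr i
  f : ∀ i, E i → (∀ j : nbr i, E j) → F i → E i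
  f_cont : ∀ i, Continuous (fun p : E i × (∀ j : nbr i, E j) × F i => f i p.1 p.2.1 p.2.2)

/-- The right-hand side `f(x, u) = (f_i(x_i, x̄_i, u_i))_i` of the interconnection. -/
def Network.rhs (N : Network E F) (x : lp E ∞) (u : lp F ∞) (i : ℕ) : E i :=
  N.f i (x i) (fun j => x j) (u i)

/-- Local solution on `[0, T)` of the Cauchy problem of the `i`-th subsystem, with internal
input `w`, external input `v` and initial state `z₀`. -/
def Network.IsSubsystemSolution (N : Network E F) (i : ℕ) (w : ℝ → ∀ j : N.nbr i, E j)
    (v : ℝ → F i) (z₀ : E i) (T : EReal) (z : ℝ → E i) : Prop :=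
  0 < T ∧ LocallyIntegrableOn (fun s => N.f i (z s) (w s) (v s)) (timeIco T) ∧
    ∀ t ∈ timeIco T, z t = z₀ + ∫ s in (0 : ℝ)..t, N.f i (z s) (w s) (v s)

/-- Unique local solvability of every subsystem, for all essentially bounded inputs. -/
def Network.SubsystemsWellPosed (N : Network E F) : Prop :=
  ∀ (i : ℕ) (w : ℝ → ∀ j : N.nbr i, E j) (v : ℝ → F i) (z₀ : E i),
    MemLp w ∞ (volume.restrict (Ici 0)) → MemLp v ∞ (volume.restrict (Ici 0)) →
      (∃ T z, N.IsSubsystemSolution i w v z₀ T z) ∧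
      ∀ T₁ z₁ T₂ z₂, N.IsSubsystemSolution i w v z₀ T₁ z₁ → N.IsSubsystemSolution i w v z₀ T₂ z₂ →
        ∀ t ∈ timeIco T₁ ∩ timeIco T₂, z₁ t = z₂ t

/-- Admissible inputs: essentially bounded and piecewise right-continuous on `[0, ∞)`
(values at negative times are irrelevant). -/
structure IsAdmissible (u : ℝ → lp F ∞) : Prop where
  memLp : MemLp u ∞ (volume.restrict (Ici 0))
  piecewise : ∃ a : ℕ → ℝ, a 0 = 0 ∧ StrictMono a ∧ Tendsto a atTop atTop ∧
    ∀ n, ContinuousOn u (Ico (a n) (a (n + 1)))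

/-- The `L∞`-norm of an input on `[0, ∞)`. -/
noncomputable def inputNorm (u : ℝ → lp F ∞) : ℝ :=
  (eLpNorm u ∞ (volume.restrict (Ici 0))).toReal

/-- `φ` is a solution on `[0, T)` of `ẋ = f(x, u)`, `x(0) = x₀`: the function
`s ↦ f(φ(s), u(s))` has values in `X`, is locally (Bochner) integrable, and `φ` satisfies the
integral equation. -/
def Network.IsSolution (N : Network E F) (u : ℝ → lp F ∞) (x₀ : lp E ∞) (T : EReal)
    (φ : ℝ → lp E ∞) : Prop :=
  0 < T ∧ ∃ g : ℝ → lp E ∞,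
    (∀ s ∈ timeIco T, ∀ i, g s i = N.rhs (φ s) (u s) i) ∧
    LocallyIntegrableOn g (timeIco T) ∧
    ∀ t ∈ timeIco T, φ t = x₀ + ∫ s in (0 : ℝ)..t, g s

/-- Well-posedness: local solutions exist and are unique. -/
def Network.WellPosed (N : Network E F) : Prop :=
  ∀ (u : ℝ → lp F ∞) (x₀ : lp E ∞), IsAdmissible u →
    (∃ T φ, N.IsSolution u x₀ T φ) ∧
    ∀ T₁ φ₁ T₂ φ₂, N.IsSolution u x₀ T₁ φ₁ → N.IsSolution u x₀ T₂ φ₂ →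
      ∀ t ∈ timeIco T₁ ∩ timeIco T₂, φ₁ t = φ₂ t

/-- Boundedness-implies-continuation: every bounded solution on a bounded time interval can be
extended to a larger time interval. -/
def Network.BIC (N : Network E F) : Prop :=
  ∀ (u : ℝ → lp F ∞) (x₀ : lp E ∞) (T : ℝ) (φ : ℝ → lp E ∞), IsAdmissible u →
    N.IsSolution u x₀ T φ → (∃ M : ℝ, ∀ t ∈ timeIco T, ‖φ t‖ ≤ M) →
      ∃ (T' : EReal) (φ' : ℝ → lp E ∞), (T : EReal) < T' ∧ N.IsSolution u x₀ T' φ' ∧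
        ∀ t ∈ timeIco T, φ' t = φ t

/-- The right upper Dini derivative of `V` at `x` along a trajectory `φ` starting at `x`. -/
noncomputable def upperDini (V : lp E ∞ → ℝ) (x : lp E ∞) (φ : ℝ → lp E ∞) : EReal :=
  limsup (fun t : ℝ => (((V (φ t) - V x) / t : ℝ) : EReal)) (𝓝[>] 0)

/-- Continuity and coercivity, the properties shared by both kinds of ISS Lyapunov functions. -/
structure IsCoerciveCandidate (V : lp E ∞ → ℝ) : Prop where
  cont : Continuous V
  coercive : ∃ ψ₁ ψ₂ : ℝ → ℝ, ClassKInf ψ₁ ∧ ClassKInf ψ₂ ∧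
    ∀ x, ψ₁ ‖x‖ ≤ V x ∧ V x ≤ ψ₂ ‖x‖

/-- ISS Lyapunov function in implication form. The orbital derivative is taken along a local
solution `φ` starting at `x`, which for a well-posed network is unique on any common interval. -/
structure Network.IsISSLyapunovImplication (N : Network E F) (V : lp E ∞ → ℝ) : Prop
    extends IsCoerciveCandidate V where
  decay : ∃ γ α : ℝ → ℝ, ClassK γ ∧ ClassP α ∧
    ∀ (x : lp E ∞) (u : ℝ → lp F ∞), IsAdmissible u → γ (inputNorm u) < V x →
      ∀ T φ, N.IsSolution u x T φ → upperDini V x φ ≤ ((-α (V x) : ℝ) : EReal)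

/-- ISS Lyapunov function in dissipative form. -/
structure Network.IsISSLyapunovDissipative (N : Network E F) (V : lp E ∞ → ℝ) : Prop
    extends IsCoerciveCandidate V where
  dissipation : ∃ α ρ : ℝ → ℝ, ClassKInf α ∧ ClassK ρ ∧
    ∀ (x : lp E ∞) (u : ℝ → lp F ∞), IsAdmissible u →
      ∀ T φ, N.IsSolution u x T φ →
        upperDini V x φ ≤ ((-α (V x) + ρ (inputNorm u) : ℝ) : EReal)

/-- The composite function `V(x) = sup_i V_i(x_i) / s⁰_i`. -/
noncomputable def supLyapunov (V : ∀ i, E i → ℝ≥0) (s₀ : EllInf) (x : lp E ∞) : ℝ :=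
  ⨆ i, (V i (x i) : ℝ) / s₀ i

end Net

end InfNet

/-!
The first claim rests on two facts. Since `Γ` is monotone, homogeneous and subadditive with spectral
radius less than one, a finite sum of scaled iterates of `Γ` on the constant sequence is a point `s`
in the interior of the cone with `Γ s ≤ l s` for some `l < 1` (`exists_decay_point`). For such an
`s`, the indices at which `V_i (x_i) / s_i` is close to the supremum `v` satisfy
`V_i (x_i) > l v s_i ≥ μ_i (γ_ij V_j (x_j))_j`, so that the subsystem estimates apply as long as the
input is small compared with `v`. The functions `V_i / s_i` are equicontinuous along a trajectory,
as the `V_i` are uniformly Lipschitz on bounded sets. Hence the set of relevant indices may be fixed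
on a short time interval, and the decay of each `V_i`, uniform in `i`, passes to the supremum
(`Network.IsSolution.upperDini_supLyapunov_le`). Admissible inputs are continuous from the right,
so solutions are differentiable from the right and the input is bounded pointwise by its norm
(`Network.IsSolution.exists_hasDerivWithinAt`).

The second claim holds for every Lyapunov function `W` in implication form whose Lipschitz constant
on the ball of radius `R` depends continuously on `R` and vanishes as `R → 0`
(`Network.IsISSLyapunovImplication.exists_dissipative`). A scaling `ξ` with `ξ' ≥ 1`, large where
the decay rate `α` is small far from the origin, makes `ξ' α` dominate a class `K∞` function
(`ClassP.exists_scaling`). In the region `W x ≤ γ ‖u‖`, where the implication gives nothing, the Dini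
derivative of `W` is at most its local Lipschitz constant times `‖f (x, u 0)‖`; this and the decay
rate are bounded by a class `K` function of `‖u‖` (`exists_classK_bound`).
-/

open Set Filter Topology MeasureTheory
open scoped ENNReal NNReal

namespace InfNet

/-! ### Comparison functions -/

theorem ClassK.monotoneOn {α : ℝ → ℝ} (h : ClassK α) : MonotoneOn α (Ici 0) :=
  h.strictMono.monotoneOn

theorem ClassK.nonneg {α : ℝ → ℝ} (h : ClassK α) {r : ℝ} (hr : 0 ≤ r) : 0 ≤ α r := by
  have := h.monotoneOn (mem_Ici.2 le_rfl) hr hr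
  rwa [h.zero] at this

theorem ClassK.mapsTo {α : ℝ → ℝ} (h : ClassK α) : MapsTo α (Ici 0) (Ici 0) :=
  fun _ hr => h.nonneg hr

theorem ClassK.comp {α β : ℝ → ℝ} (hα : ClassK α) (hβ : ClassK β) :
    ClassK (fun r => α (β r)) where
  cont := hα.cont.comp hβ.cont hβ.mapsTo
  zero := by simp [hβ.zero, hα.zero]
  strictMono := hα.strictMono.comp hβ.strictMono hβ.mapsTo

theorem ClassKInf.comp {α β : ℝ → ℝ} (hα : ClassKInf α) (hβ : ClassKInf β) :
    ClassKInf (fun r => α (β r)) where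
  toClassK := hα.toClassK.comp hβ.toClassK
  unbounded := hα.unbounded.comp hβ.unbounded

theorem ClassK.div_const {α : ℝ → ℝ} (hα : ClassK α) {c : ℝ} (hc : 0 < c) :
    ClassK (fun r => α r / c) where
  cont := hα.cont.div_const c
  zero := by simp [hα.zero]
  strictMono := fun _ hx _ hy hxy => div_lt_div_of_pos_right (hα.strictMono hx hy hxy) hc

theorem ClassKInf.div_const {α : ℝ → ℝ} (hα : ClassKInf α) {c : ℝ} (hc : 0 < c) :
    ClassKInf (fun r => α r / c) where
  toClassK := hα.toClassK.div_const hc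
  unbounded := hα.unbounded.atTop_div_const hc

/-- A strictly increasing continuous bijection of `ℝ` that fixes `0` restricts to a function of
class `K∞`. -/
theorem ClassKInf.of_orderIso (e : ℝ ≃o ℝ) (h0 : e 0 = 0) : ClassKInf e where
  cont := e.continuous.continuousOn
  zero := h0
  strictMono := e.strictMono.strictMonoOn _
  unbounded := e.tendsto_atTop

theorem ClassP.nonneg {α : ℝ → ℝ} (hα : ClassP α) {r : ℝ} (hr : 0 ≤ r) : 0 ≤ α r := by
  rcases hr.eq_or_lt with rfl | h
  · exact hα.zero.ge
  · exact (hα.pos r h).le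

/-- The witness is `r ↦ min {α (τ r) | a ≤ τ ≤ b}`. -/
theorem ClassP.exists_le_scaled {α : ℝ → ℝ} (hα : ClassP α) {a b : ℝ} (ha : 0 < a)
    (hab : a ≤ b) :
    ∃ β : ℝ → ℝ, ClassP β ∧ ∀ r, 0 ≤ r → ∀ τ ∈ Icc a b, β r ≤ α (τ * r) := by
  let g : ℝ → ℝ → ℝ := fun r τ => α (max (τ * r) 0)
  have hg : Continuous ↿g := by
    have h1 : Continuous (fun p : ℝ × ℝ => max (p.2 * p.1) 0) := by fun_prop
    exact hα.cont.comp_continuous h1 fun _ => mem_Ici.2 (le_max_right _ _)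
  have hg' : ∀ r, ContinuousOn (g r) (Icc a b) := fun r =>
    (hg.comp (Continuous.prodMk_right r)).continuousOn
  have hne : (Icc a b).Nonempty := nonempty_Icc.2 hab
  refine ⟨fun r => sInf (g r '' Icc a b), ⟨?_, ?_, ?_⟩, ?_⟩
  · exact (isCompact_Icc.continuous_sInf hg).continuousOn
  · obtain ⟨τ, -, h⟩ := isCompact_Icc.exists_sInf_image_eq hne (hg' 0)
    simp only [h, g]
    simp [hα.zero]
  · intro r hr
    obtain ⟨τ, hτ, h⟩ := isCompact_Icc.exists_sInf_image_eq hne (hg' r)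
    have h1 : 0 < τ * r := mul_pos (ha.trans_le hτ.1) hr
    simp only [h, g, max_eq_left h1.le]
    exact hα.pos _ h1
  · intro r hr τ hτ
    have h1 : 0 ≤ τ * r := mul_nonneg (ha.le.trans hτ.1) hr
    have := csInf_le (isCompact_Icc.image_of_continuousOn (hg' r)).bddBelow
      (mem_image_of_mem (g r) hτ)
    simpa only [g, max_eq_left h1] using this

/-- A positive definite function becomes a function of class `K∞` after multiplication with a
continuous `h ≥ 1` that is constant near the origin. With `κ s = min {α τ | s ≤ τ ≤ 1}`, the
lower bound is `s κ(s)` on `[0, 1]`, where `h = 1`; on `[1, ∞)` the function `h` is at least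
`s α(1) / α(s)`, so that `h α` dominates the linear function `s α(1)`. -/
theorem ClassP.exists_classKInf_le_mul {α : ℝ → ℝ} (hα : ClassP α) :
    ∃ h κ : ℝ → ℝ, Continuous h ∧ (∀ s, 1 ≤ h s) ∧ (∀ s ≤ 1, h s = 1) ∧ ClassKInf κ ∧
      ∀ s, 0 ≤ s → κ s ≤ h s * α s := by
  have hα1 := hα.pos 1 one_pos
  let g : ℝ → ℝ → ℝ := fun s τ => α (max (max s τ) 0)
  have hg : Continuous ↿g := by
    have h1 : Continuous (fun p : ℝ × ℝ => max (max p.1 p.2) 0) := by fun_prop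
    exact hα.cont.comp_continuous h1 fun _ => mem_Ici.2 (le_max_right _ _)
  have hg' : ∀ s, ContinuousOn (g s) (Icc 0 1) := fun s =>
    (hg.comp (Continuous.prodMk_right s)).continuousOn
  have hne : (Icc (0 : ℝ) 1).Nonempty := nonempty_Icc.2 zero_le_one
  let k : ℝ → ℝ := fun s => sInf (g s '' Icc 0 1)
  have hk : Continuous k := isCompact_Icc.continuous_sInf hg
  have hkle : ∀ s, ∀ τ ∈ Icc (0 : ℝ) 1, k s ≤ g s τ := fun s τ hτ =>
    csInf_le (isCompact_Icc.image_of_continuousOn (hg' s)).bddBelow (mem_image_of_mem (g s) hτ)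
  have hkpos : ∀ s, 0 < s → 0 < k s := by
    intro s hs
    obtain ⟨τ, hτ, h⟩ := isCompact_Icc.exists_sInf_image_eq hne (hg' s)
    simp only [k, h, g]
    exact hα.pos _ (lt_max_of_lt_left (lt_max_of_lt_left hs))
  have hkmono : ∀ s t, 0 ≤ s → s ≤ t → t ≤ 1 → k s ≤ k t := by
    intro s t hs hst ht
    obtain ⟨τ, hτ, h⟩ := isCompact_Icc.exists_sInf_image_eq hne (hg' t)
    have h1 : max t τ ∈ Icc (0 : ℝ) 1 := ⟨hτ.1.trans (le_max_right _ _), max_le ht hτ.2⟩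
    have h2 := hkle s _ h1
    simp only [k, h, g] at h2 ⊢
    rwa [max_eq_right (hst.trans (le_max_left t τ))] at h2
  have hk1 : k 1 = α 1 := by
    obtain ⟨τ, hτ, h⟩ := isCompact_Icc.exists_sInf_image_eq hne (hg' 1)
    simp only [k, h, g, max_eq_left hτ.2, max_eq_left (zero_le_one' ℝ)]
  have hkα : ∀ s ∈ Icc (0 : ℝ) 1, k s ≤ α s := by
    intro s hs
    have := hkle s s hs
    simpa only [g, max_self, max_eq_left hs.1] using this
  have hαm : ∀ s, 0 < α (max s 1) := fun s => hα.pos _ (lt_max_of_lt_right one_pos)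
  refine ⟨fun s => max 1 (max s 1 * α 1 / α (max s 1)), fun s => s * k (min s 1), ?_, ?_, ?_,
    ⟨⟨?_, ?_, ?_⟩, ?_⟩, ?_⟩
  · have h1 : Continuous (fun s => α (max s 1)) :=
      hα.cont.comp_continuous (by fun_prop) fun s => mem_Ici.2 (zero_le_one.trans (le_max_right s 1))
    have h2 : Continuous (fun s => max s 1 * α 1 / α (max s 1)) :=
      Continuous.div (by fun_prop) h1 fun s => (hαm s).ne'
    exact continuous_const.max h2
  · exact fun s => le_max_left _ _
  · intro s hs
    simp [max_eq_right hs, hα1.ne']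
  · exact (continuous_id.mul (hk.comp (by fun_prop))).continuousOn
  · simp
  · intro s hs t ht hst
    have ht0 : 0 < t := lt_of_le_of_lt hs hst
    have h1 : k (min s 1) ≤ k (min t 1) :=
      hkmono _ _ (le_min hs zero_le_one) (min_le_min_right _ hst.le) (min_le_right _ _)
    have h2 : 0 < k (min t 1) := hkpos _ (lt_min ht0 one_pos)
    calc s * k (min s 1) ≤ s * k (min t 1) := mul_le_mul_of_nonneg_left h1 hs
      _ < t * k (min t 1) := mul_lt_mul_of_pos_right hst h2
  · refine Tendsto.congr' ?_ (tendsto_id.atTop_mul_const hα1)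
    filter_upwards [eventually_ge_atTop 1] with s hs
    simp [min_eq_right hs, hk1]
  · intro s hs
    rcases le_total s 1 with h1 | h1
    · have h2 := hkα s ⟨hs, h1⟩
      have h3 : 0 ≤ α s := hα.nonneg hs
      have h4 : s * α s ≤ 1 * α s := mul_le_mul_of_nonneg_right h1 h3
      simp only [min_eq_left h1, max_eq_right h1]
      rw [one_mul, div_self hα1.ne', max_self]
      exact (mul_le_mul_of_nonneg_left h2 hs).trans h4
    · have hαs : 0 < α s := hα.pos s (one_pos.trans_le h1)
      simp only [min_eq_right h1, max_eq_left h1, hk1]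
      calc s * α 1 = s * α 1 / α s * α s := by field_simp
        _ ≤ _ := mul_le_mul_of_nonneg_right (le_max_right _ _) hαs.le

/-- For a decay rate `α` of class `P` there is a nonlinear scaling `ξ` such that the decay rate
`ξ'(s) α(s)` of `ξ ∘ V` is bounded below by a function of class `K∞` of `ξ(s)`. -/
theorem ClassP.exists_scaling {α : ℝ → ℝ} (hα : ClassP α) :
    ∃ ξ κ : ℝ → ℝ, IsNonlinearScaling ξ ∧ ContDiff ℝ 1 ξ ∧ (∀ s, 0 < deriv ξ s) ∧
      ClassKInf κ ∧ ∀ s, 0 ≤ s → κ (ξ s) ≤ deriv ξ s * α s := by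
  obtain ⟨h, κ, hcont, h1, hle, hκ, hκα⟩ := hα.exists_classKInf_le_mul
  let ξ : ℝ → ℝ := fun s => ∫ t in (0 : ℝ)..s, h t
  have hint : ∀ a b, IntervalIntegrable h volume a b := fun a b => hcont.intervalIntegrable a b
  have hd : ∀ s, HasDerivAt ξ (h s) s := fun s =>
    intervalIntegral.integral_hasDerivAt_right (hint 0 s)
      hcont.stronglyMeasurable.stronglyMeasurableAtFilter hcont.continuousAt
  have hderiv : deriv ξ = h := funext fun s => (hd s).deriv
  have hC1 : ContDiff ℝ 1 ξ :=
    contDiff_one_iff_deriv.2 ⟨fun s => (hd s).differentiableAt, by rwa [hderiv]⟩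
  have hpos : ∀ s, 0 < deriv ξ s := fun s => by
    rw [hderiv]
    exact one_pos.trans_le (h1 s)
  have hmono : StrictMono ξ := strictMono_of_deriv_pos hpos
  have hξ0 : ξ 0 = 0 := intervalIntegral.integral_same
  have hξge : ∀ s, 0 ≤ s → s ≤ ξ s := by
    intro s hs
    have := intervalIntegral.integral_mono_on hs (intervalIntegrable_const (c := (1 : ℝ)))
      (hint 0 s) fun t _ => h1 t
    simpa using this
  have hξle : ∀ s ≤ 0, ξ s = s := by
    intro s hs
    have : ξ s = ∫ t in (0 : ℝ)..s, (1 : ℝ) := by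
      refine intervalIntegral.integral_congr fun t ht => ?_
      rw [uIcc_of_ge hs] at ht
      exact hle t (ht.2.trans zero_le_one)
    simpa using this
  have htop : Tendsto ξ atTop atTop := by
    refine tendsto_atTop_mono' _ ?_ tendsto_id
    filter_upwards [eventually_ge_atTop 0] with s hs using hξge s hs
  have hbot : Tendsto ξ atBot atBot := by
    refine Tendsto.congr' ?_ tendsto_id
    filter_upwards [eventually_le_atBot 0] with s hs using (hξle s hs).symm
  have hsurj : Function.Surjective ξ := hC1.continuous.surjective htop hbot
  let e : ℝ ≃o ℝ := hmono.orderIsoOfSurjective ξ hsurj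
  have he : ∀ s, e.symm (ξ s) = s := fun s => e.symm_apply_apply s
  refine ⟨ξ, fun w => κ (e.symm w), ⟨ClassKInf.of_orderIso e hξ0, hC1.contDiffOn,
    fun s _ => hpos s, 1, ?_⟩, hC1, hpos, hκ.comp (ClassKInf.of_orderIso e.symm ?_), ?_⟩
  · rw [hderiv, ← hle 0 zero_le_one]
    exact hcont.continuousAt.mono_left nhdsWithin_le_nhds
  · rw [← hξ0, he, hξ0]
  · intro s hs
    simp only [he, hderiv]
    exact hκα s hs

/-- The witness is `r + r⁻¹ ∫_r^{2r} B`, which is continuous even where `B` is not. -/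
theorem exists_classK_ge_of_monotone {B : ℝ → ℝ} (hB : Monotone B) (h0 : B 0 = 0)
    (hlim : Tendsto B (𝓝[>] 0) (𝓝 0)) : ∃ ρ, ClassK ρ ∧ ∀ r, 0 ≤ r → B r ≤ ρ r := by
  have hint : ∀ a b, IntervalIntegrable B volume a b := fun a b => hB.intervalIntegrable
  let A : ℝ → ℝ := fun r => ∫ τ in (1 : ℝ)..2, B (τ * r)
  have hmonoτ : ∀ r, 0 ≤ r → Monotone fun τ => B (τ * r) := fun r hr a b hab =>
    hB (mul_le_mul_of_nonneg_right hab hr)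
  have hintτ : ∀ r, 0 ≤ r → IntervalIntegrable (fun τ => B (τ * r)) volume 1 2 :=
    fun r hr => (hmonoτ r hr).intervalIntegrable
  have hAmono : MonotoneOn A (Ici 0) := by
    intro r hr s hs hrs
    refine intervalIntegral.integral_mono_on one_le_two (hintτ r hr)
      (hintτ s hs) fun τ hτ => hB ?_
    exact mul_le_mul_of_nonneg_left hrs (zero_le_one.trans hτ.1)
  have hA0 : A 0 = 0 := by simp [A, h0]
  have hBA : ∀ r, 0 ≤ r → B r ≤ A r := by
    intro r hr
    have := intervalIntegral.integral_mono_on one_le_two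
      (intervalIntegrable_const (c := B r)) (hintτ r hr) fun τ hτ =>
        hB (le_mul_of_one_le_left hr hτ.1)
    simpa [show (2 : ℝ) - 1 = 1 by norm_num] using this
  have hAB : ∀ r, 0 ≤ r → A r ≤ B (2 * r) := by
    intro r hr
    have := intervalIntegral.integral_mono_on one_le_two
      (hintτ r hr) (intervalIntegrable_const (c := B (2 * r))) fun τ hτ =>
        hB (mul_le_mul_of_nonneg_right hτ.2 hr)
    simpa [show (2 : ℝ) - 1 = 1 by norm_num] using this
  have hAeq : ∀ r, 0 < r → A r = r⁻¹ * ((∫ t in (0 : ℝ)..2 * r, B t) - ∫ t in (0 : ℝ)..r, B t) := by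
    intro r hr
    rw [intervalIntegral.integral_interval_sub_left (hint _ _) (hint _ _)]
    simp only [A]
    rw [intervalIntegral.integral_comp_mul_right _ hr.ne', one_mul, smul_eq_mul]
  have hprim : Continuous fun r => ∫ t in (0 : ℝ)..r, B t :=
    intervalIntegral.continuous_primitive hint 0
  have hAcont : ContinuousOn A (Ici 0) := by
    intro r hr
    rcases (mem_Ici.1 hr).eq_or_lt with rfl | hr
    · rw [← continuousWithinAt_sdiff_self]
      have hset : Ici (0 : ℝ) \ {0} = Ioi 0 := by
        ext t
        simp [lt_iff_le_and_ne, eq_comm]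
      rw [hset, ContinuousWithinAt, hA0]
      have h2 : Tendsto (fun r : ℝ => 2 * r) (𝓝[>] 0) (𝓝[>] 0) := by
        refine tendsto_nhdsWithin_iff.2 ⟨?_, ?_⟩
        · have : ContinuousAt (fun r : ℝ => 2 * r) 0 := by fun_prop
          have h3 := this.tendsto
          rw [mul_zero] at h3
          exact h3.mono_left nhdsWithin_le_nhds
        · filter_upwards [self_mem_nhdsWithin] with t ht
          exact mul_pos two_pos (mem_Ioi.1 ht)
      refine tendsto_of_tendsto_of_tendsto_of_le_of_le' hlim (hlim.comp h2) ?_ ?_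
      · filter_upwards [self_mem_nhdsWithin] with t ht using hBA t (le_of_lt ht)
      · filter_upwards [self_mem_nhdsWithin] with t ht using hAB t (le_of_lt ht)
    · have h1 : ContinuousAt (fun r => r⁻¹ * ((∫ t in (0 : ℝ)..2 * r, B t) -
          ∫ t in (0 : ℝ)..r, B t)) r := by
        refine (continuousAt_inv₀ hr.ne').mul (Continuous.continuousAt ?_)
        exact (hprim.comp (by fun_prop : Continuous fun r : ℝ => 2 * r)).sub hprim
      refine (h1.congr ?_).continuousWithinAt
      filter_upwards [lt_mem_nhds hr] with t ht using (hAeq t ht).symm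
  refine ⟨fun r => r + A r, ⟨continuousOn_id.add hAcont, by simp [hA0], ?_⟩, ?_⟩
  · intro r hr s hs hrs
    exact add_lt_add_of_lt_of_le hrs (hAmono hr hs hrs.le)
  · intro r hr
    exact (hBA r hr).trans (le_add_of_nonneg_left hr)

/-- An increasing family of sets `S r` of real numbers, bounded above and with
arbitrarily small upper bounds as `r → 0`, is bounded above by a function of class `K`. -/
theorem exists_classK_bound {S : ℝ → Set ℝ} (hmono : Monotone S)
    (hbdd : ∀ r, BddAbove (S r))
    (hsmall : ∀ ε > 0, ∃ δ > 0, ∀ b ∈ S δ, b ≤ ε) :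
    ∃ ρ, ClassK ρ ∧ ∀ r, 0 ≤ r → ∀ b ∈ S r, b ≤ ρ r := by
  let B : ℝ → ℝ := fun r => sSup (insert 0 (S r))
  have hbdd' : ∀ r, BddAbove (insert 0 (S r)) := fun r => (hbdd r).insert 0
  have hB : Monotone B := fun r s hrs =>
    csSup_le_csSup (hbdd' s) (insert_nonempty _ _) (insert_subset_insert (hmono hrs))
  have hpos : ∀ r, 0 ≤ B r := fun r => le_csSup (hbdd' r) (mem_insert _ _)
  have hsm : ∀ ε > 0, ∃ δ > 0, B δ ≤ ε := by
    intro ε hε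
    obtain ⟨δ, hδ, h⟩ := hsmall ε hε
    refine ⟨δ, hδ, csSup_le (insert_nonempty _ _) ?_⟩
    rintro b (rfl | hb)
    · exact hε.le
    · exact h b hb
  have h0 : B 0 = 0 := by
    refine le_antisymm (le_of_forall_pos_le_add fun ε hε => ?_) (hpos 0)
    obtain ⟨δ, hδ, h⟩ := hsm ε hε
    rw [zero_add]
    exact (hB hδ.le).trans h
  have hlim : Tendsto B (𝓝[>] 0) (𝓝 0) := by
    refine Metric.tendsto_nhds.2 fun ε hε => ?_
    obtain ⟨δ, hδ, h⟩ := hsm (ε / 2) (half_pos hε)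
    filter_upwards [Ioo_mem_nhdsGT hδ] with r hr
    rw [Real.dist_0_eq_abs, abs_of_nonneg (hpos r)]
    linarith [hB hr.2.le]
  obtain ⟨ρ, hρ, hle⟩ := exists_classK_ge_of_monotone hB h0 hlim
  exact ⟨ρ, hρ, fun r hr b hb => (le_csSup (hbdd' r) (mem_insert_of_mem _ hb)).trans (hle r hr)⟩

/-! ### The positive cone and the gain operator -/

theorem exists_lower_bound_of_mem_interior {s₀ : EllInf}
    (h : s₀ ∈ interior (posCone : Set EllInf)) : ∃ c > 0, ∀ i, c ≤ s₀ i := by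
  obtain ⟨ε, hε, hball⟩ := Metric.isOpen_iff.1 isOpen_interior s₀ h
  refine ⟨ε / 2, half_pos hε, fun i => ?_⟩
  have h1 : s₀ - (ε / 2) • (1 : EllInf) ∈ Metric.ball s₀ ε := by
    rw [Metric.mem_ball, dist_eq_norm, sub_sub_cancel_left, norm_neg, norm_smul, norm_one, mul_one,
      Real.norm_of_nonneg (half_pos hε).le]
    exact half_lt_self hε
  have h2 : 0 ≤ (s₀ - (ε / 2) • (1 : EllInf)) i := interior_subset (hball h1) i
  have h3 : (s₀ - (ε / 2) • (1 : EllInf)) i = s₀ i - ε / 2 := by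
    rw [lp.coeFn_sub, Pi.sub_apply, lp.coeFn_smul, Pi.smul_apply, lp.infty_coeFn_one]
    simp
  linarith

theorem mem_interior_posCone {s₀ : EllInf} {c : ℝ} (hc : 0 < c) (h : ∀ i, c ≤ s₀ i) :
    s₀ ∈ interior (posCone : Set EllInf) := by
  refine mem_interior.2 ⟨Metric.ball s₀ c, fun s hs i => ?_, Metric.isOpen_ball,
    Metric.mem_ball_self hc⟩
  rw [Metric.mem_ball, dist_eq_norm] at hs
  have h1 := (lp.norm_apply_le_norm ENNReal.top_ne_zero (s - s₀) i).trans_lt hs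
  rw [lp.coeFn_sub, Pi.sub_apply, Real.norm_eq_abs] at h1
  linarith [(abs_lt.1 h1).1, h i]

theorem EllInf.le_norm (s : EllInf) (i : ℕ) : s i ≤ ‖s‖ :=
  (le_abs_self _).trans (lp.norm_apply_le_norm ENNReal.top_ne_zero s i)

theorem posCone_coe_add (r s : posCone) (i : ℕ) : (r + s).1 i = r.1 i + s.1 i := rfl

theorem posCone_coe_smul (c : ℝ≥0) (s : posCone) (i : ℕ) : (c • s).1 i = c * s.1 i := rfl

section GainOperator

variable {μ : ℕ → posCone → ℝ≥0∞} {γ : ℕ → ℕ →₀ ℝ≥0}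

theorem gainRow_mono {g : ℕ →₀ ℝ≥0} {v w : ℕ → ℝ≥0} (h : ∀ j, v j ≤ w j) (j : ℕ) :
    (gainRow g v).1 j ≤ (gainRow g w).1 j :=
  NNReal.coe_le_coe.2 (mul_le_mul_right (h j) (g j))

theorem gainComp_smul (hμ : ∀ i, IsMHAF (μ i)) (c : ℝ≥0) (s : posCone) (i : ℕ) :
    gainComp μ γ (c • s) i = c * gainComp μ γ s i := by
  rw [gainComp, gainComp, ← (hμ i).homogeneous]
  congr 1
  refine Subtype.ext (lp.ext (funext fun j => ?_))
  change ((γ i j : ℝ)) * (c * s.1 j) = c * (γ i j * s.1 j)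
  ring

theorem gainComp_add_le (hμ : ∀ i, IsMHAF (μ i)) (r s : posCone) (i : ℕ) :
    gainComp μ γ (r + s) i ≤ gainComp μ γ r i + gainComp μ γ s i := by
  rw [gainComp, gainComp, gainComp]
  refine le_of_eq_of_le (congrArg _ ?_) ((hμ i).subadditive _ _)
  refine Subtype.ext (lp.ext (funext fun j => ?_))
  change ((γ i j : ℝ)) * (r.1 j + s.1 j) = γ i j * r.1 j + γ i j * s.1 j
  ring

theorem gainComp_ne_top (hΓ : GainWellDefined μ γ) (s : posCone) (i : ℕ) :
    gainComp μ γ s i ≠ ∞ := by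
  obtain ⟨C, hC⟩ := hΓ s
  exact ne_top_of_le_ne_top ENNReal.coe_ne_top (hC i)

theorem ofReal_gainOp (hΓ : GainWellDefined μ γ) (s : posCone) (i : ℕ) :
    ENNReal.ofReal ((gainOp μ γ hΓ s).1 i) = gainComp μ γ s i :=
  ENNReal.ofReal_toReal (gainComp_ne_top hΓ s i)

theorem gainOp_smul (hμ : ∀ i, IsMHAF (μ i)) (hΓ : GainWellDefined μ γ) (c : ℝ≥0) (s : posCone)
    (i : ℕ) : (gainOp μ γ hΓ (c • s)).1 i = c * (gainOp μ γ hΓ s).1 i := by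
  change (gainComp μ γ (c • s) i).toReal = c * (gainComp μ γ s i).toReal
  rw [gainComp_smul hμ, ENNReal.toReal_mul, ENNReal.coe_toReal]

theorem gainOp_add_le (hμ : ∀ i, IsMHAF (μ i)) (hΓ : GainWellDefined μ γ) (r s : posCone)
    (i : ℕ) :
    (gainOp μ γ hΓ (r + s)).1 i ≤ (gainOp μ γ hΓ r).1 i + (gainOp μ γ hΓ s).1 i := by
  change (gainComp μ γ (r + s) i).toReal ≤
    (gainComp μ γ r i).toReal + (gainComp μ γ s i).toReal
  rw [← ENNReal.toReal_add (gainComp_ne_top hΓ r i) (gainComp_ne_top hΓ s i)]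
  exact ENNReal.toReal_mono
    (ENNReal.add_ne_top.2 ⟨gainComp_ne_top hΓ r i, gainComp_ne_top hΓ s i⟩)
    (gainComp_add_le hμ r s i)

/-- If `r(Γ) < 1`, then `Γ` has a point of strict decay in the interior of the cone: with
`r(Γ) < l < 1` and `n` such that `‖Γⁿ(𝟙)‖ ≤ lⁿ`, the finite sum `∑_{k < n} l⁻ᵏ Γᵏ(𝟙)` is mapped by
the subadditive and homogeneous `Γ` to at most `l` times itself, because the top term
`l⁻ⁿ Γⁿ(𝟙)` of the shifted sum is bounded by the bottom term `𝟙`. -/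
theorem exists_decay_point (hμ : ∀ i, IsMHAF (μ i)) (hΓ : GainWellDefined μ γ) {r : ℝ≥0∞}
    (hr : r < 1) (hrad : HasSpectralRadius (gainOp μ γ hΓ) r) :
    ∃ (s : posCone) (l : ℝ), 0 < l ∧ l < 1 ∧ (∀ i, 1 ≤ s.1 i) ∧
      ∀ i, (gainOp μ γ hΓ s).1 i ≤ l * s.1 i := by
  obtain ⟨l', hl', hl1'⟩ := exists_between hr
  lift l' to ℝ≥0 using hl1'.ne_top
  have hl0 : 0 < l' := by
    have := (zero_le (a := r)).trans_lt hl'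
    exact_mod_cast this
  have hl1 : l' < 1 := by exact_mod_cast hl1'
  set Γ := gainOp μ γ hΓ with hΓdef
  have h1mem : (1 : EllInf) ∈ posCone := fun i => by
    rw [lp.infty_coeFn_one]
    exact zero_le_one
  let e : posCone := ⟨1, h1mem⟩
  have he : ∀ i, e.1 i = 1 := fun i => by
    change (1 : EllInf) i = 1
    rw [lp.infty_coeFn_one]
    rfl
  obtain ⟨n, hn0, hn⟩ : ∃ n : ℕ, 0 < n ∧ ∀ i, (Γ^[n] e).1 i ≤ (l' : ℝ) ^ n := by
    obtain ⟨n, hn, hn0⟩ := ((hrad.eventually_lt_const hl').and (eventually_gt_atTop 0)).exists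
    refine ⟨n, hn0, fun i => ?_⟩
    have h1 : ‖((Γ^[n] e : posCone) : EllInf)‖ₑ ^ (1 / (n : ℝ)) ≤ l' :=
      (le_iSup (fun s : {s : posCone // ‖(s : EllInf)‖ = 1} =>
        ‖((Γ^[n] s.1 : posCone) : EllInf)‖ₑ ^ (1 / (n : ℝ))) ⟨e, norm_one⟩).trans hn.le
    have h2 := ENNReal.rpow_le_rpow h1 (Nat.cast_nonneg n : (0 : ℝ) ≤ n)
    rw [← ENNReal.rpow_mul, one_div, inv_mul_cancel₀ (Nat.cast_ne_zero.2 hn0.ne'),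
      ENNReal.rpow_one, ENNReal.rpow_natCast, ← ENNReal.coe_pow, enorm_le_coe,
      ← NNReal.coe_le_coe, coe_nnnorm, NNReal.coe_pow] at h2
    exact (EllInf.le_norm _ i).trans h2
  let S : ℕ → posCone := fun m => m.rec 0 fun k s => s + (l'⁻¹ ^ k) • (Γ^[k] e)
  have hS0 : S 0 = 0 := rfl
  have hSsucc : ∀ m, S (m + 1) = S m + (l'⁻¹ ^ m) • (Γ^[m] e) := fun m => rfl
  have hstep : ∀ m i, (Γ (S m)).1 i ≤
      l' * ((S m).1 i + ((l'⁻¹ ^ m : ℝ≥0) : ℝ) * (Γ^[m] e).1 i - 1) := by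
    intro m i
    induction m with
    | zero =>
      have h1 := gainOp_smul hμ hΓ 0 0 i
      rw [NNReal.coe_zero, zero_mul] at h1
      have h2 : (0 : ℝ≥0) • (0 : posCone) = 0 :=
        Subtype.ext (smul_zero (0 : ℝ≥0))
      rw [h2] at h1
      rw [hS0, hΓdef, h1]
      simp [he]
    | succ m ih =>
      rw [hSsucc]
      refine (gainOp_add_le hμ hΓ _ _ i).trans ?_
      rw [gainOp_smul hμ, posCone_coe_add, posCone_coe_smul, Function.iterate_succ_apply']
      have h1 : ((l'⁻¹ ^ m : ℝ≥0) : ℝ) = l' * ((l'⁻¹ ^ (m + 1) : ℝ≥0) : ℝ) := by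
        rw [← NNReal.coe_mul, pow_succ' l'⁻¹, mul_inv_cancel_left₀ hl0.ne']
      have h2 : ((l'⁻¹ ^ m : ℝ≥0) : ℝ) * (Γ (Γ^[m] e)).1 i =
          l' * (((l'⁻¹ ^ (m + 1) : ℝ≥0) : ℝ) * (Γ (Γ^[m] e)).1 i) := by
        rw [h1]; ring
      rw [← hΓdef, h2]
      linarith
  have hSge : ∀ m i, 1 ≤ (S (m + 1)).1 i := by
    intro m i
    induction m with
    | zero =>
      rw [hSsucc, hS0, posCone_coe_add, posCone_coe_smul]
      simp [he]
    | succ m ih =>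
      have := mul_nonneg (l'⁻¹ ^ (m + 1)).2 ((Γ^[m + 1] e).2 i)
      exact ih.trans (le_add_of_nonneg_right this)
  refine ⟨S n, l', hl0, hl1, fun i => ?_, fun i => (hstep n i).trans ?_⟩
  · obtain ⟨m, rfl⟩ := Nat.exists_eq_succ_of_ne_zero hn0.ne'
    exact hSge m i
  · refine mul_le_mul_of_nonneg_left ?_ l'.2
    have h1 : ((l'⁻¹ ^ n : ℝ≥0) : ℝ) * (Γ^[n] e).1 i ≤ 1 := by
      refine (mul_le_mul_of_nonneg_left (hn i) (l'⁻¹ ^ n).2).trans_eq ?_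
      change ((l'⁻¹ ^ n : ℝ≥0) : ℝ) * (l' : ℝ) ^ n = 1
      rw [← NNReal.coe_pow, ← NNReal.coe_mul, inv_pow, inv_mul_cancel₀ (pow_ne_zero n hl0.ne'),
        NNReal.coe_one]
    linarith

/-- Small gain estimate: a sequence bounded by `v s`, for a point of decay `s`, is mapped by `Γ`
below `l v s`. -/
theorem gain_le_of_le_decay_point (hμ : ∀ i, IsMHAF (μ i)) (hΓ : GainWellDefined μ γ)
    {s : posCone} {l : ℝ} (hs : ∀ i, (gainOp μ γ hΓ s).1 i ≤ l * s.1 i) {w : ℕ → ℝ≥0} {v : ℝ}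
    (hv : 0 ≤ v) (hw : ∀ j, (w j : ℝ) ≤ v * s.1 j) (i : ℕ) :
    μ i (gainRow (γ i) w) ≤ ENNReal.ofReal (l * v * s.1 i) := by
  lift v to ℝ≥0 using hv
  calc μ i (gainRow (γ i) w) ≤ gainComp μ γ (v • s) i :=
        (hμ i).monotone _ _ (gainRow_mono fun j => NNReal.coe_le_coe.1 (hw j))
    _ = ENNReal.ofReal ((gainOp μ γ hΓ (v • s)).1 i) := (ofReal_gainOp hΓ _ i).symm
    _ ≤ _ := by
      rw [gainOp_smul hμ]
      refine ENNReal.ofReal_le_ofReal ?_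
      calc (v : ℝ) * (gainOp μ γ hΓ s).1 i ≤ v * (l * s.1 i) :=
            mul_le_mul_of_nonneg_left (hs i) v.2
        _ = l * v * s.1 i := by ring

end GainOperator

/-! ### Inputs, trajectories and Dini derivatives -/

section Dynamics

universe u v

variable {E : ℕ → Type u} {F : ℕ → Type v}
  [∀ i, NormedAddCommGroup (E i)] [∀ i, NormedAddCommGroup (F i)]

theorem inputNorm_nonneg (u : ℝ → lp F ∞) : 0 ≤ inputNorm u := ENNReal.toReal_nonneg

/-- By right-continuity the essential bound on an admissible input holds pointwise; only the first
interval of continuity is needed. -/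
theorem IsAdmissible.exists_continuousOn {u : ℝ → lp F ∞} (hu : IsAdmissible u) :
    ∃ δ > 0, ContinuousOn u (Ico 0 δ) ∧ ∀ t ∈ Ico 0 δ, ‖u t‖ ≤ inputNorm u := by
  obtain ⟨a, ha0, hamono, -, hcont⟩ := hu.piecewise
  have h01 : 0 < a 1 := ha0 ▸ hamono one_pos
  have hc : ContinuousOn u (Ico 0 (a 1)) := by
    have := hcont 0
    rwa [ha0, zero_add] at this
  refine ⟨a 1, h01, hc, fun t ht => ?_⟩
  have hae : ∀ᵐ s, s ∈ Ici (0 : ℝ) → ‖u s‖ ≤ inputNorm u := by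
    refine (ae_restrict_iff' measurableSet_Ici).1 ?_
    filter_upwards [ae_le_eLpNormEssSup (f := u) (μ := volume.restrict (Ici 0))] with s hs
    rw [← eLpNorm_exponent_top] at hs
    have := ENNReal.toReal_mono hu.memLp.2.ne hs
    rwa [toReal_enorm] at this
  have hlim : Tendsto (fun s => ‖u s‖) (𝓝[>] t) (𝓝 ‖u t‖) := by
    have h1 : Tendsto u (𝓝[Ico 0 (a 1)] t) (𝓝 (u t)) := hc t ht
    refine (h1.mono_left ?_).norm
    rw [← nhdsWithin_Ioo_eq_nhdsGT ht.2]
    exact nhdsWithin_mono _ fun s hs => ⟨ht.1.trans hs.1.le, hs.2⟩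
  refine le_of_tendsto_of_frequently hlim fun hev => ?_
  obtain ⟨b, hb, hsub⟩ := mem_nhdsGT_iff_exists_Ioo_subset.1 hev
  have h2 : volume (Ioo t b) = 0 := by
    refine measure_mono_null (fun s hs => ?_) hae
    exact fun h => hsub hs (h (mem_Ici.2 (ht.1.trans hs.1.le)))
  rw [Real.volume_Ioo, ENNReal.ofReal_eq_zero] at h2
  linarith [mem_Ioi.1 hb]

/-- Near `t = 0` a solution satisfies the differential equation from the right, since the input is
continuous there. -/
theorem Network.IsSolution.exists_hasDerivWithinAt
    [∀ i, NormedSpace ℝ (E i)] [∀ i, CompleteSpace (E i)]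
    {N : Network E F} {f : lp E ∞ × lp F ∞ → lp E ∞} (hf : ∀ x u i, f (x, u) i = N.rhs x u i)
    (hfcont : Continuous f) {u : ℝ → lp F ∞} (hu : IsAdmissible u) {x : lp E ∞} {T : EReal}
    {φ : ℝ → lp E ∞} (h : N.IsSolution u x T φ) :
    φ 0 = x ∧ ∃ δ > 0, ContinuousOn φ (Ico 0 δ) ∧ ∀ t ∈ Ico 0 δ, ‖u t‖ ≤ inputNorm u ∧
      HasDerivWithinAt φ (f (φ t, u t)) (Ici t) t := by
  obtain ⟨hT, g, hg, hint, hφ⟩ := h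
  obtain ⟨δ₁, hδ₁, hucont, hule⟩ := hu.exists_continuousOn
  obtain ⟨T', hT'0, hT'⟩ := EReal.lt_iff_exists_real_btwn.1 hT
  have hT'pos : 0 < T' := by exact_mod_cast hT'0
  have hmem : ∀ t, 0 ≤ t → t ≤ T' → t ∈ timeIco T := fun t h0 h1 =>
    ⟨h0, lt_of_le_of_lt (by exact_mod_cast h1) hT'⟩
  have hii : ∀ t, 0 ≤ t → t ≤ T' → IntervalIntegrable g volume 0 t := fun t h0 h1 => by
    rw [intervalIntegrable_iff_integrableOn_Icc_of_le h0]
    exact hint.integrableOn_compact_subset (fun s hs => hmem s hs.1 (hs.2.trans h1))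
      isCompact_Icc
  have hφcont : ContinuousOn φ (Icc 0 T') := by
    have h1 := intervalIntegral.continuousOn_primitive_interval' (hii T' hT'pos.le le_rfl)
      (left_mem_uIcc (a := (0 : ℝ)) (b := T'))
    rw [uIcc_of_le hT'pos.le] at h1
    exact (continuousOn_const.add h1).congr fun t ht => hφ t (hmem t ht.1 ht.2)
  set δ := min δ₁ T' with hδ
  have hφcont' : ContinuousOn φ (Ico 0 δ) :=
    hφcont.mono fun t ht => ⟨ht.1, ht.2.le.trans (min_le_right _ _)⟩
  have hgf : ∀ t ∈ Ico 0 δ, g t = f (φ t, u t) := fun t ht =>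
    lp.ext (funext fun i => by
      rw [hf, hg t (hmem t ht.1 (ht.2.le.trans (min_le_right _ _))) i])
  have hgcont : ContinuousOn g (Ico 0 δ) := by
    refine ContinuousOn.congr ?_ hgf
    exact hfcont.comp_continuousOn
      (hφcont'.prodMk (hucont.mono (Ico_subset_Ico_right (min_le_left _ _))))
  refine ⟨?_, δ, lt_min hδ₁ hT'pos, hφcont', fun t ht =>
    ⟨hule t ⟨ht.1, ht.2.trans_le (min_le_left _ _)⟩, ?_⟩⟩
  · have := hφ 0 (hmem 0 le_rfl hT'pos.le)
    rwa [intervalIntegral.integral_same, add_zero] at this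
  have hIoo : Ioo t δ ⊆ Ico 0 δ := fun s hs => ⟨ht.1.trans hs.1.le, hs.2⟩
  have hmeas : StronglyMeasurableAtFilter g (𝓝[>] t) volume := by
    rw [← nhdsWithin_Ioo_eq_nhdsGT ht.2]
    exact (hgcont.mono hIoo).stronglyMeasurableAtFilter_nhdsWithin measurableSet_Ioo t
  have hgt : ContinuousWithinAt g (Ioi t) t := by
    rw [ContinuousWithinAt, ← nhdsWithin_Ioo_eq_nhdsGT ht.2]
    exact (hgcont t ht).mono hIoo
  have hd := intervalIntegral.integral_hasDerivWithinAt_right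
    (hii t ht.1 (ht.2.le.trans (min_le_right _ _))) (s := Ici t) hmeas hgt
  rw [← hgf t ht]
  refine (hd.const_add x).congr_of_eventuallyEq ?_
    (hφ t (hmem t ht.1 (ht.2.le.trans (min_le_right _ _))))
  filter_upwards [Ico_mem_nhdsGE ht.2] with s hs
  exact hφ s (hmem s (ht.1.trans hs.1) (hs.2.le.trans (min_le_right _ _)))

theorem upperDini_le_iff {V : lp E ∞ → ℝ} {x : lp E ∞} {φ : ℝ → lp E ∞} {d : ℝ} :
    upperDini V x φ ≤ (d : EReal) ↔
      ∀ d' > d, ∀ᶠ t in 𝓝[>] (0 : ℝ), (V (φ t) - V x) / t ≤ d' := by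
  rw [upperDini, limsup_le_iff]
  constructor
  · intro h d' hd'
    filter_upwards [h d' (EReal.coe_lt_coe_iff.2 hd')] with t ht
    exact (EReal.coe_lt_coe_iff.1 ht).le
  · intro h y hy
    obtain ⟨d', hd', hd'y⟩ := EReal.lt_iff_exists_real_btwn.1 hy
    filter_upwards [h d' (EReal.coe_lt_coe_iff.1 hd')] with t ht
    exact (EReal.coe_le_coe_iff.2 ht).trans_lt hd'y

/-- Chain rule inequality for Dini derivatives. -/
theorem upperDini_comp_le {V : lp E ∞ → ℝ} {x : lp E ∞} {φ : ℝ → lp E ∞} {d : ℝ} {ξ : ℝ → ℝ}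
    (hξ : DifferentiableAt ℝ ξ (V x)) (hpos : 0 < deriv ξ (V x))
    (hV : Tendsto (fun t => V (φ t)) (𝓝[>] 0) (𝓝 (V x)))
    (h : upperDini V x φ ≤ (d : EReal)) :
    upperDini (fun y => ξ (V y)) x φ ≤ ((deriv ξ (V x) * d : ℝ) : EReal) := by
  rw [upperDini_le_iff] at h ⊢
  intro d' hd'
  set q : ℝ → ℝ := dslope ξ (V x) with hq
  have hqx : q (V x) = deriv ξ (V x) := dslope_same ξ (V x)
  have hqlim : Tendsto (fun t => q (V (φ t))) (𝓝[>] 0) (𝓝 (deriv ξ (V x))) := by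
    rw [← hqx]
    exact (continuousAt_dslope_same.2 hξ).tendsto.comp hV
  obtain ⟨d'', hd'', hlt⟩ : ∃ d'' > d, deriv ξ (V x) * d'' < d' := by
    obtain ⟨z, hz, hz'⟩ := exists_between ((lt_div_iff₀' hpos).2 hd')
    exact ⟨z, hz, (lt_div_iff₀' hpos).1 hz'⟩
  filter_upwards [h d'' hd'', hqlim.eventually (lt_mem_nhds hpos),
    (hqlim.mul_const d'').eventually (gt_mem_nhds hlt)] with t h1 h2 h3
  have h4 : ξ (V (φ t)) - ξ (V x) = q (V (φ t)) * (V (φ t) - V x) := by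
    rw [hq, mul_comm, ← smul_eq_mul, sub_smul_dslope]
  rw [h4, mul_div_assoc]
  exact (mul_le_mul_of_nonneg_left h1 h2.le).trans h3.le

/-- A function that is Lipschitz with constant `K` near `x` has Dini derivative at most `K ‖φ'(0)‖`
along `φ`. -/
theorem upperDini_le_of_lipschitz [∀ i, NormedSpace ℝ (E i)] {V : lp E ∞ → ℝ}
    {x y : lp E ∞} {φ : ℝ → lp E ∞} {K : ℝ}
    (hx : φ 0 = x) (hφ : HasDerivWithinAt φ y (Ici 0) 0)
    (hV : ∀ᶠ z in 𝓝 x, |V z - V x| ≤ K * ‖z - x‖) :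
    upperDini V x φ ≤ ((K * ‖y‖ : ℝ) : EReal) := by
  rw [upperDini_le_iff]
  intro d' hd'
  have h1 : Tendsto (fun t => K * ‖t⁻¹ • (φ t - x)‖) (𝓝[>] 0) (𝓝 (K * ‖y‖)) := by
    have := (hasDerivWithinAt_iff_tendsto_slope' (by simp)).1 (hφ.mono Ioi_subset_Ici_self)
    refine ((this.congr fun t => ?_).norm).const_mul K
    rw [slope_def_module, sub_zero, hx]
  have h2 : Tendsto φ (𝓝[>] 0) (𝓝 x) := by
    have := (hφ.mono Ioi_subset_Ici_self).continuousWithinAt.tendsto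
    rwa [hx] at this
  filter_upwards [h1.eventually (gt_mem_nhds hd'), h2.eventually hV, self_mem_nhdsWithin]
    with t ht1 ht2 ht0
  have ht0 : 0 < t := ht0
  refine le_trans ?_ ht1.le
  rw [norm_smul, norm_inv, Real.norm_of_nonneg ht0.le, div_le_iff₀ ht0]
  refine (le_abs_self _).trans (ht2.trans_eq ?_)
  field_simp

end Dynamics

/-! ### The composite function `sup_i V_i / s⁰_i` -/

section Composite

universe u

variable {E : ℕ → Type u} [∀ i, NormedAddCommGroup (E i)]
  {V : ∀ i, E i → ℝ≥0} {ψ₁ ψ₂ : ℝ → ℝ} {s₀ : EllInf} {c : ℝ}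

theorem bddAbove_range_supLyapunov (hψ₂ : ClassK ψ₂) (hVψ₂ : ∀ i z, (V i z : ℝ) ≤ ψ₂ ‖z‖)
    (hc : 0 < c) (hs : ∀ i, c ≤ s₀ i) (x : lp E ∞) :
    BddAbove (range fun i => (V i (x i) : ℝ) / s₀ i) := by
  refine ⟨ψ₂ ‖x‖ / c, ?_⟩
  rintro _ ⟨i, rfl⟩
  refine div_le_div₀ (hψ₂.nonneg (norm_nonneg x)) ?_ hc (hs i)
  exact (hVψ₂ i _).trans (hψ₂.monotoneOn (norm_nonneg _) (norm_nonneg x)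
    (lp.norm_apply_le_norm ENNReal.top_ne_zero x i))

theorem div_le_supLyapunov (hψ₂ : ClassK ψ₂) (hVψ₂ : ∀ i z, (V i z : ℝ) ≤ ψ₂ ‖z‖)
    (hc : 0 < c) (hs : ∀ i, c ≤ s₀ i) (x : lp E ∞) (i : ℕ) :
    (V i (x i) : ℝ) / s₀ i ≤ supLyapunov V s₀ x :=
  le_ciSup (bddAbove_range_supLyapunov hψ₂ hVψ₂ hc hs x) i

theorem le_supLyapunov_mul (hψ₂ : ClassK ψ₂) (hVψ₂ : ∀ i z, (V i z : ℝ) ≤ ψ₂ ‖z‖)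
    (hc : 0 < c) (hs : ∀ i, c ≤ s₀ i) (x : lp E ∞) (i : ℕ) :
    (V i (x i) : ℝ) ≤ supLyapunov V s₀ x * s₀ i :=
  (div_le_iff₀ (hc.trans_le (hs i))).1 (div_le_supLyapunov hψ₂ hVψ₂ hc hs x i)

theorem supLyapunov_nonneg (hc : 0 < c) (hs : ∀ i, c ≤ s₀ i) (x : lp E ∞) :
    0 ≤ supLyapunov V s₀ x :=
  Real.iSup_nonneg fun i => div_nonneg (V i (x i)).2 (hc.le.trans (hs i))

/-- The local Lipschitz constants of the functions `V_i`, uniform in `i`, pass to `V_i / s⁰_i`. -/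
theorem abs_div_sub_div_le (hc : 0 < c) (hs : ∀ i, c ≤ s₀ i) {L R : ℝ} (hL0 : 0 ≤ L)
    (hL : ∀ i (y z : E i), ‖y‖ < R → ‖z‖ < R → |(V i y : ℝ) - V i z| ≤ L * ‖y - z‖)
    {x y : lp E ∞} (hx : ‖x‖ < R) (hy : ‖y‖ < R) (i : ℕ) :
    |(V i (x i) : ℝ) / s₀ i - V i (y i) / s₀ i| ≤ L / c * ‖x - y‖ := by
  have hsi := hc.trans_le (hs i)
  have hle : ∀ z : lp E ∞, ‖z i‖ ≤ ‖z‖ := fun z => lp.norm_apply_le_norm ENNReal.top_ne_zero z i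
  rw [← sub_div, abs_div, abs_of_pos hsi, div_mul_eq_mul_div]
  refine div_le_div₀ (mul_nonneg hL0 (norm_nonneg _)) ?_ hc (hs i)
  refine (hL i _ _ ((hle x).trans_lt hx) ((hle y).trans_lt hy)).trans ?_
  exact mul_le_mul_of_nonneg_left (hle (x - y)) hL0

theorem abs_supLyapunov_sub_le (hψ₂ : ClassK ψ₂) (hVψ₂ : ∀ i z, (V i z : ℝ) ≤ ψ₂ ‖z‖)
    (hc : 0 < c) (hs : ∀ i, c ≤ s₀ i) {L R : ℝ} (hL0 : 0 ≤ L)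
    (hL : ∀ i (y z : E i), ‖y‖ < R → ‖z‖ < R → |(V i y : ℝ) - V i z| ≤ L * ‖y - z‖)
    {x y : lp E ∞} (hx : ‖x‖ < R) (hy : ‖y‖ < R) :
    |supLyapunov V s₀ x - supLyapunov V s₀ y| ≤ L / c * ‖x - y‖ := by
  have key : ∀ x y : lp E ∞, ‖x‖ < R → ‖y‖ < R →
      supLyapunov V s₀ x ≤ supLyapunov V s₀ y + L / c * ‖x - y‖ := by
    intro x y hx hy
    refine ciSup_le fun i => ?_
    have h1 := (abs_le.1 (abs_div_sub_div_le hc hs hL0 hL hx hy i)).2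
    have h2 := div_le_supLyapunov hψ₂ hVψ₂ hc hs y i
    linarith
  rw [abs_le]
  have h1 := key x y hx hy
  have h2 := key y x hy hx
  rw [norm_sub_rev] at h2
  constructor <;> linarith

theorem isCoerciveCandidate_supLyapunov (hψ₁ : ClassKInf ψ₁) (hψ₂ : ClassKInf ψ₂)
    (hVψ₁ : ∀ i z, ψ₁ ‖z‖ ≤ V i z) (hVψ₂ : ∀ i z, (V i z : ℝ) ≤ ψ₂ ‖z‖)
    (hc : 0 < c) (hs : ∀ i, c ≤ s₀ i) {L : ℝ → ℝ} (hLpos : ∀ R, 0 < R → 0 < L R)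
    (hL : ∀ R, 0 < R → ∀ i (y z : E i), ‖y‖ < R → ‖z‖ < R →
      |(V i y : ℝ) - V i z| ≤ L R * ‖y - z‖) :
    IsCoerciveCandidate (supLyapunov V s₀) where
  cont := by
    refine continuous_iff_continuousAt.2 fun x => ?_
    have hR : 0 < ‖x‖ + 1 := by positivity
    rw [ContinuousAt, tendsto_iff_dist_tendsto_zero]
    have h1 : Tendsto (fun y => L (‖x‖ + 1) / c * ‖y - x‖) (𝓝 x) (𝓝 0) := by
      have : Continuous fun y => L (‖x‖ + 1) / c * ‖y - x‖ := by fun_prop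
      simpa using this.tendsto x
    refine squeeze_zero' (Eventually.of_forall fun _ => dist_nonneg) ?_ h1
    have h2 : ∀ᶠ y : lp E ∞ in 𝓝 x, ‖y‖ < ‖x‖ + 1 :=
      continuous_norm.continuousAt.eventually (gt_mem_nhds (lt_add_one ‖x‖))
    filter_upwards [h2] with y hy
    exact abs_supLyapunov_sub_le hψ₂.toClassK hVψ₂ hc hs (hLpos _ hR).le (hL _ hR) hy
      (lt_add_one _)
  coercive := by
    have hsn : 0 < ‖s₀‖ := hc.trans_le ((hs 0).trans (EllInf.le_norm s₀ 0))
    refine ⟨fun r => ψ₁ r / ‖s₀‖, fun r => ψ₂ r / c, hψ₁.div_const hsn, hψ₂.div_const hc,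
      fun x => ⟨?_, ?_⟩⟩
    · rw [div_le_iff₀ hsn]
      have hW := supLyapunov_nonneg (V := V) hc hs x
      have h1 : ∀ i, ψ₁ ‖x i‖ ≤ supLyapunov V s₀ x * ‖s₀‖ := fun i =>
        (hVψ₁ i _).trans ((le_supLyapunov_mul hψ₂.toClassK hVψ₂ hc hs x i).trans
          (mul_le_mul_of_nonneg_left (EllInf.le_norm s₀ i) hW))
      refine le_of_forall_lt_imp_le_of_dense fun z hz => ?_
      by_contra! hlt
      -- a value `ψ₁ r` strictly between `V(x) ‖s₀‖` and `ψ₁ ‖x‖` would force `‖x i‖ ≤ r` for all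
      -- `i`, hence `‖x‖ ≤ r`
      have hz0 : 0 < z := lt_of_le_of_lt (mul_nonneg hW hsn.le) hlt
      have hx0 : 0 ≤ ‖x‖ := norm_nonneg x
      have hmem : z ∈ Icc (ψ₁ 0) (ψ₁ ‖x‖) := by
        rw [hψ₁.zero]
        exact ⟨hz0.le, hz.le⟩
      obtain ⟨r, hr, rfl⟩ := intermediate_value_Icc hx0
        (hψ₁.cont.mono Icc_subset_Ici_self) hmem
      refine hz.not_ge (hψ₁.monotoneOn (norm_nonneg x) hr.1 ?_)
      refine lp.norm_le_of_forall_le hr.1 fun i => ?_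
      by_contra! hi
      exact ((h1 i).trans_lt hlt).not_ge
        (hψ₁.monotoneOn hr.1 (norm_nonneg _) hi.le)
    · refine ciSup_le fun i => ?_
      refine div_le_div₀ (hψ₂.nonneg (norm_nonneg x)) ?_ hc (hs i)
      exact (hVψ₂ i _).trans (hψ₂.monotoneOn (norm_nonneg _) (norm_nonneg x)
        (lp.norm_apply_le_norm ENNReal.top_ne_zero x i))

end Composite

section Lyapunov

universe u v

variable {E : ℕ → Type u} {F : ℕ → Type v}
  [∀ i, NormedAddCommGroup (E i)] [∀ i, NormedSpace ℝ (E i)] [∀ i, NormedAddCommGroup (F i)]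

/-! ### The implication form -/

/-- Comparison principle for a single subsystem: a decay rate of at least `β` along the component
`φ_i` yields linear decay of `V_i`. -/
theorem le_sub_mul_of_decay {i : ℕ} {W : E i → ℝ} (hW : Differentiable ℝ W)
    {φ φ' : ℝ → lp E ∞} {β δ t : ℝ} (hφ : ContinuousOn φ (Ico 0 δ))
    (hφ' : ∀ s ∈ Ico 0 δ, HasDerivWithinAt φ (φ' s) (Ici s) s)
    (hdecay : ∀ s ∈ Ico 0 δ, fderiv ℝ W (φ s i) (φ' s i) ≤ -β) (ht : t ∈ Ico 0 δ) :
    W (φ t i) ≤ W (φ 0 i) - t * β := by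
  let p : lp E ∞ →L[ℝ] E i := lp.evalCLM ℝ E ∞ i
  have hsub : Icc 0 t ⊆ Ico 0 δ := fun s hs => ⟨hs.1, hs.2.trans_lt ht.2⟩
  refine image_le_of_deriv_right_le_deriv_boundary (f := fun s => W (φ s i))
    (f' := fun s => fderiv ℝ W (φ s i) (φ' s i)) (a := 0) (b := t)
    (B := fun s => W (φ 0 i) - s * β) (B' := fun _ => -β) ?_ ?_ ?_ ?_ ?_ ?_ ⟨ht.1, le_rfl⟩
  · exact hW.continuous.comp_continuousOn (p.continuous.comp_continuousOn (hφ.mono hsub))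
  · intro s hs
    have h1 : HasDerivWithinAt (fun s => p (φ s)) (p (φ' s)) (Ici s) s :=
      p.hasFDerivAt.comp_hasDerivWithinAt s (hφ' s (hsub (Ico_subset_Icc_self hs)))
    exact (hW (p (φ s))).hasFDerivAt.comp_hasDerivWithinAt s h1
  · simp
  · fun_prop
  · intro s _
    simpa using ((hasDerivWithinAt_id s (Ici s)).mul_const β).const_sub (W (φ 0 i))
  · exact fun s hs => hdecay s (hsub (Ico_subset_Icc_self hs))

/-- Decay of `sup_i V_i / s⁰_i` along solutions. Let `v` be its initial value and
`ε = (1 - l) v / 8`. On a short time interval, all the functions `V_i / s⁰_i` move by at most `ε`,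
uniformly in `i`. An index with `V_i / s⁰_i < v - 2 ε` initially therefore does not contribute to
the decrease of the supremum. For all others, `V_i / s⁰_i ≥ v - 3 ε > l (v + ε)`, so that the small
gain estimate provides the decay of `V_i`. -/
theorem Network.IsSolution.upperDini_supLyapunov_le [∀ i, CompleteSpace (E i)]
    {N : Network E F} {f : lp E ∞ × lp F ∞ → lp E ∞} (hf : ∀ x u i, f (x, u) i = N.rhs x u i)
    (hfcont : Continuous f)
    {V : ∀ i, E i → ℝ≥0} (hVdiff : ∀ i, Differentiable ℝ fun z => (V i z : ℝ))
    {ψ₂ : ℝ → ℝ} (hψ₂ : ClassK ψ₂) (hVψ₂ : ∀ i z, (V i z : ℝ) ≤ ψ₂ ‖z‖)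
    {μ : ℕ → posCone → ℝ≥0∞} (hμ : ∀ i, IsMHAF (μ i)) {γ : ℕ → ℕ →₀ ℝ≥0}
    (hΓ : GainWellDefined μ γ) {s : posCone} {l c : ℝ} (hl0 : 0 < l) (hl1 : l < 1)
    (hs : ∀ i, (gainOp μ γ hΓ s).1 i ≤ l * s.1 i) (hc : 0 < c) (hsc : ∀ i, c ≤ s.1 i)
    {γmax : ℝ → ℝ} (hγmax : ClassK γmax) {αt : ℝ → ℝ}
    (hdecay : ∀ (i : ℕ) (x : lp E ∞) (u : lp F ∞),
      max (μ i (gainRow (γ i) (fun j => V j (x j)))) (ENNReal.ofReal (γmax ‖u‖))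
          < (V i (x i) : ℝ≥0∞) →
        fderiv ℝ (fun z => (V i z : ℝ)) (x i) (N.rhs x u i) ≤ -αt (V i (x i)))
    {L R : ℝ} (hL0 : 0 ≤ L)
    (hL : ∀ i (y z : E i), ‖y‖ < R → ‖z‖ < R → |(V i y : ℝ) - V i z| ≤ L * ‖y - z‖)
    {β : ℝ} (hβ0 : 0 ≤ β) {x : lp E ∞} (hxR : ‖x‖ < R)
    (hβ : ∀ τ ∈ Icc (c / 2) (2 * ‖(s : EllInf)‖), β ≤ αt (τ * supLyapunov V s.1 x))
    {u : ℝ → lp F ∞} (hu : IsAdmissible u)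
    (hux : γmax (inputNorm u) / (c / 2) < supLyapunov V s.1 x)
    {T : EReal} {φ : ℝ → lp E ∞} (hφ : N.IsSolution u x T φ) :
    upperDini (supLyapunov V s.1) x φ ≤ ((-(β / ‖(s : EllInf)‖) : ℝ) : EReal) := by
  obtain ⟨hφ0, δ₁, hδ₁, hφc, hφd⟩ := hφ.exists_hasDerivWithinAt hf hfcont hu
  set C : ℝ := ‖(s : EllInf)‖ with hC
  set v : ℝ := supLyapunov V s.1 x with hv
  have hsC : ∀ i, s.1 i ≤ C := fun i => EllInf.le_norm s.1 i
  have hs0 : ∀ i, 0 < s.1 i := fun i => hc.trans_le (hsc i)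
  have hC0 : 0 < C := (hs0 0).trans_le (hsC 0)
  have hv0 : 0 < v :=
    (div_nonneg (hγmax.nonneg (inputNorm_nonneg u)) (half_pos hc).le).trans_lt hux
  set ε : ℝ := (1 - l) * v / 8 with hε
  have hε0 : 0 < ε := by
    have := mul_pos (sub_pos.2 hl1) hv0
    positivity
  have hlv : 0 < l * v := mul_pos hl0 hv0
  have hlε : 0 ≤ (1 - l) * ε := mul_nonneg (sub_nonneg.2 hl1.le) hε0.le
  have hε8 : 8 * ε = v - l * v := by rw [hε]; ring
  set d : ℕ → lp E ∞ → ℝ := fun i y => (V i (y i) : ℝ) / s.1 i with hd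
  have hdle : ∀ y i, d i y ≤ supLyapunov V s.1 y := fun y i =>
    div_le_supLyapunov hψ₂ hVψ₂ hc hsc y i
  -- on a short time interval all the functions `V_i / s⁰_i` move by at most `ε`
  obtain ⟨δ, hδ0, hδδ₁, hsmall⟩ : ∃ δ > 0, δ ≤ δ₁ ∧ ∀ t ∈ Ico 0 δ, ∀ i,
      |d i (φ t) - d i x| ≤ ε := by
    have h1 : Tendsto φ (𝓝[≥] 0) (𝓝 x) := by
      have h2 := hφc 0 ⟨le_rfl, hδ₁⟩
      rw [ContinuousWithinAt, nhdsWithin_Ico_eq_nhdsGE hδ₁, hφ0] at h2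
      exact h2
    have h2 : Tendsto (fun y => L / c * ‖y - x‖) (𝓝 x) (𝓝 0) := by
      have : Continuous fun y => L / c * ‖y - x‖ := by fun_prop
      simpa using this.tendsto x
    have h3 := (h1.eventually (continuous_norm.continuousAt.eventually (gt_mem_nhds hxR))).and
      ((h2.comp h1).eventually (gt_mem_nhds hε0))
    obtain ⟨b, hb, hsub⟩ := mem_nhdsGE_iff_exists_Ico_subset.1 h3
    refine ⟨min b δ₁, lt_min hb hδ₁, min_le_right _ _, fun t ht i => ?_⟩
    obtain ⟨h4, h5⟩ := hsub ⟨ht.1, ht.2.trans_le (min_le_left _ _)⟩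
    exact (abs_div_sub_div_le hc hsc hL0 hL h4 hxR i).trans h5.le
  have hsup : ∀ t ∈ Ico 0 δ, supLyapunov V s.1 (φ t) ≤ v + ε := fun t ht =>
    ciSup_le fun i => by linarith [(abs_le.1 (hsmall t ht i)).2, hdle x i]
  have hactive : ∀ i, v - 2 * ε ≤ d i x → ∀ t ∈ Ico 0 δ,
      fderiv ℝ (fun z => (V i z : ℝ)) (φ t i) (f (φ t, u t) i) ≤ -β := by
    intro i hi t ht
    have ht₁ : t ∈ Ico 0 δ₁ := ⟨ht.1, ht.2.trans_le hδδ₁⟩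
    have hVd : (V i (φ t i) : ℝ) = d i (φ t) * s.1 i := (div_mul_cancel₀ _ (hs0 i).ne').symm
    have h1 := abs_le.1 (hsmall t ht i)
    have h2 : v / 2 ≤ d i (φ t) := by linarith
    have h3 : l * (v + ε) < d i (φ t) := by linarith
    have hw0 : 0 ≤ v + ε := by linarith
    have hgain : μ i (gainRow (γ i) fun j => V j (φ t j)) < (V i (φ t i) : ℝ≥0∞) := by
      refine (gain_le_of_le_decay_point hμ hΓ hs hw0 (fun j => ?_) i).trans_lt ?_
      · exact (le_supLyapunov_mul hψ₂ hVψ₂ hc hsc (φ t) j).trans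
          (mul_le_mul_of_nonneg_right (hsup t ht) (hs0 j).le)
      · rw [← ENNReal.ofReal_coe_nnreal, hVd]
        exact (ENNReal.ofReal_lt_ofReal_iff (mul_pos (by linarith) (hs0 i))).2
          (mul_lt_mul_of_pos_right h3 (hs0 i))
    have hinput : ENNReal.ofReal (γmax ‖u t‖) < (V i (φ t i) : ℝ≥0∞) := by
      have h4 : γmax ‖u t‖ ≤ γmax (inputNorm u) :=
        hγmax.monotoneOn (norm_nonneg _) (inputNorm_nonneg u) (hφd t ht₁).1
      have h5 : γmax (inputNorm u) < v * (c / 2) := (div_lt_iff₀ (half_pos hc)).1 hux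
      have h6 : v / 2 * c ≤ d i (φ t) * s.1 i :=
        mul_le_mul h2 (hsc i) hc.le (by linarith)
      have h7 : γmax ‖u t‖ < V i (φ t i) := by linarith
      rw [← ENNReal.ofReal_coe_nnreal]
      exact (ENNReal.ofReal_lt_ofReal_iff ((hγmax.nonneg (norm_nonneg _)).trans_lt h7)).2 h7
    have h8 := hdecay i (φ t) (u t) (max_lt hgain hinput)
    rw [← hf] at h8
    refine h8.trans (neg_le_neg ?_)
    have h9 : (V i (φ t i) : ℝ) = d i (φ t) * s.1 i / v * v := by
      rw [hVd, div_mul_cancel₀ _ hv0.ne']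
    rw [h9]
    refine hβ _ ⟨?_, ?_⟩
    · rw [le_div_iff₀ hv0]
      linarith [mul_le_mul h2 (hsc i) hc.le (by linarith : 0 ≤ d i (φ t))]
    · rw [div_le_iff₀ hv0]
      have h10 : d i (φ t) ≤ 2 * v := by linarith [hdle x i]
      linarith [mul_le_mul h10 (hsC i) (hs0 i).le (by linarith)]
  rw [upperDini_le_iff]
  intro d' hd'
  have hlin : ∀ᶠ t in 𝓝[>] (0 : ℝ), t * (β / C) < ε := by
    have h1 : Tendsto (fun t : ℝ => t * (β / C)) (𝓝 0) (𝓝 0) := by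
      have : Continuous fun t : ℝ => t * (β / C) := by fun_prop
      simpa using this.tendsto 0
    exact (h1.mono_left nhdsWithin_le_nhds).eventually (gt_mem_nhds hε0)
  filter_upwards [hlin, Ioo_mem_nhdsGT hδ0] with t ht htδ
  refine le_trans ?_ hd'.le
  have ht' : t ∈ Ico 0 δ := ⟨htδ.1.le, htδ.2⟩
  rw [div_le_iff₀ htδ.1]
  suffices h : supLyapunov V s.1 (φ t) ≤ v - t * (β / C) by linarith
  refine ciSup_le fun i => ?_
  change d i (φ t) ≤ _
  rcases lt_or_ge (d i x) (v - 2 * ε) with hi | hi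
  · linarith [(abs_le.1 (hsmall t ht' i)).2]
  · have h1 := le_sub_mul_of_decay (hVdiff i) (φ' := fun s => f (φ s, u s))
      (hφc.mono (Ico_subset_Ico_right hδδ₁))
      (fun s hs => (hφd s ⟨hs.1, hs.2.trans_le hδδ₁⟩).2) (hactive i hi) ht'
    rw [hφ0] at h1
    have h2 : d i (φ t) ≤ d i x - t * (β / s.1 i) := by
      rw [hd]
      dsimp only
      rw [← mul_div_assoc, ← sub_div]
      exact div_le_div_of_nonneg_right h1 (hs0 i).le
    have h3 : t * (β / C) ≤ t * (β / s.1 i) :=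
      mul_le_mul_of_nonneg_left (div_le_div_of_nonneg_left hβ0 (hs0 i) (hsC i)) htδ.1.le
    linarith [hdle x i]

/-! ### The dissipative form -/

/-- The Dini derivative is controlled by the local Lipschitz constant at radius `‖x‖` itself, the
limit of the constants at larger radii. -/
theorem upperDini_le_of_continuous_lipschitz {W : lp E ∞ → ℝ} {K : ℝ → ℝ}
    (hKcont : ContinuousOn K (Ici 0))
    (hW : ∀ R, 0 < R → ∀ x y : lp E ∞, ‖x‖ < R → ‖y‖ < R → |W x - W y| ≤ K R * ‖x - y‖)
    {x y : lp E ∞} {φ : ℝ → lp E ∞} (hx : φ 0 = x) (hφ : HasDerivWithinAt φ y (Ici 0) 0) :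
    upperDini W x φ ≤ ((K ‖x‖ * ‖y‖ : ℝ) : EReal) := by
  have hlim : Tendsto (fun R => ((K R * ‖y‖ : ℝ) : EReal)) (𝓝[>] ‖x‖)
      (𝓝 ((K ‖x‖ * ‖y‖ : ℝ) : EReal)) := by
    refine (continuous_coe_real_ereal.tendsto _).comp (Tendsto.mul_const _ ?_)
    exact (hKcont ‖x‖ (norm_nonneg x)).mono_left
      (nhdsWithin_mono _ fun R hR => (norm_nonneg x).trans (le_of_lt hR))
  refine ge_of_tendsto hlim ?_
  filter_upwards [self_mem_nhdsWithin] with R hR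
  have hR0 : 0 < R := (norm_nonneg x).trans_lt hR
  refine upperDini_le_of_lipschitz hx hφ ?_
  filter_upwards [continuous_norm.continuousAt.eventually (gt_mem_nhds hR)] with z hz
  exact hW R hR0 z x hz hR

/-- A Lyapunov function in implication form can be rescaled to one in dissipative form, if its local
Lipschitz constant `K` tends to `0` at the origin and `f` is bounded on bounded sets. Where
`W x > γ ‖u‖`, a nonlinear scaling turns the decay rate into one of class `K∞`. Where
`W x ≤ γ ‖u‖`, both the Dini derivative, by Lipschitz continuity, and the decay rate are bounded
in terms of `‖u‖` alone, and these bounds tend to `0` with `‖u‖`. -/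
theorem Network.IsISSLyapunovImplication.exists_dissipative [∀ i, CompleteSpace (E i)]
    {N : Network E F} {f : lp E ∞ × lp F ∞ → lp E ∞} (hf : ∀ x u i, f (x, u) i = N.rhs x u i)
    (hfcont : Continuous f)
    (hfbdd : ∀ R, 0 < R → ∃ C : ℝ, ∀ x u, ‖x‖ ≤ R → ‖u‖ ≤ R → ‖f (x, u)‖ ≤ C)
    {W : lp E ∞ → ℝ} (h : N.IsISSLyapunovImplication W) {K : ℝ → ℝ}
    (hK0 : ∀ r, 0 ≤ r → 0 ≤ K r) (hKcont : ContinuousOn K (Ici 0)) (hKzero : K 0 = 0)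
    (hW : ∀ R, 0 < R → ∀ x y : lp E ∞, ‖x‖ < R → ‖y‖ < R → |W x - W y| ≤ K R * ‖x - y‖) :
    ∃ ξ : ℝ → ℝ, IsNonlinearScaling ξ ∧ N.IsISSLyapunovDissipative (fun x => ξ (W x)) := by
  obtain ⟨ψ₁, ψ₂, hψ₁, hψ₂, hψ⟩ := h.coercive
  obtain ⟨γ, α, hγ, hα, hdecay⟩ := h.decay
  obtain ⟨ξ, κ, hξ, hξC1, hξpos, hκ, hκα⟩ := hα.exists_scaling
  have hWnonneg : ∀ x, 0 ≤ W x := fun x => (hψ₁.nonneg (norm_nonneg x)).trans (hψ x).1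
  have hξ' : Continuous (deriv ξ) := hξC1.continuous_deriv le_rfl
  have hκξ : ClassK fun r => κ (ξ r) := hκ.toClassK.comp hξ.toClassK
  have hderivBdd : ∀ b, ∃ M, 0 ≤ M ∧ ∀ w ∈ Icc 0 b, deriv ξ w ≤ M := by
    intro b
    obtain ⟨M, hM⟩ := (isCompact_Icc.image_of_continuousOn
      (s := Icc 0 b) hξ'.continuousOn).bddAbove
    exact ⟨max M 0, le_max_right _ _, fun w hw =>
      (hM (mem_image_of_mem _ hw)).trans (le_max_left _ _)⟩
  have hnorm : ∀ x η, 0 ≤ η → W x < ψ₁ η → ‖x‖ < η := by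
    intro x η hη hx
    by_contra! hle
    exact (((hψ₁.monotoneOn hη (norm_nonneg x) hle).trans (hψ x).1).trans_lt hx).false
  let S : ℝ → Set ℝ := fun r => {b | ∃ x v, W x ≤ γ r ∧ ‖v‖ ≤ r ∧
    b = deriv ξ (W x) * (K ‖x‖ * ‖f (x, v)‖) + κ (ξ (W x))}
  have hSmono : Monotone S := by
    rintro r r' hrr' _ ⟨x, v, hx, hv, rfl⟩
    have hr : 0 ≤ r := (norm_nonneg v).trans hv
    exact ⟨x, v, hx.trans (hγ.monotoneOn hr (hr.trans hrr') hrr'), hv.trans hrr', rfl⟩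
  have hSle : ∀ r R M k C, 0 ≤ M → 0 ≤ k → (∀ w ∈ Icc 0 (γ r), deriv ξ w ≤ M) →
      (∀ x, W x ≤ γ r → ‖x‖ ≤ R ∧ K ‖x‖ ≤ k) → r ≤ R →
      (∀ x v, ‖x‖ ≤ R → ‖v‖ ≤ R → ‖f (x, v)‖ ≤ C) →
      ∀ b ∈ S r, b ≤ M * (k * C) + κ (ξ (γ r)) := by
    rintro r R M k C hM0 hk0 hM hk hrR hC _ ⟨x, v, hx, hv, rfl⟩
    have hr : 0 ≤ r := (norm_nonneg v).trans hv
    refine add_le_add ?_ (hκξ.monotoneOn (hWnonneg x) (hγ.nonneg hr) hx)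
    refine mul_le_mul (hM _ ⟨hWnonneg x, hx⟩) ?_
      (mul_nonneg (hK0 _ (norm_nonneg x)) (norm_nonneg _)) hM0
    exact mul_le_mul (hk x hx).2 (hC x v (hk x hx).1 (hv.trans hrR)) (norm_nonneg _) hk0
  have hSbdd : ∀ r, BddAbove (S r) := by
    intro r
    obtain ⟨R, hRγ, hR⟩ := ((hψ₁.unbounded.eventually_gt_atTop (γ r)).and
      (eventually_ge_atTop (max r 1))).exists
    have hR0 : 0 < R := one_pos.trans_le ((le_max_right r 1).trans hR)
    obtain ⟨M, hM0, hM⟩ := hderivBdd (γ r)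
    obtain ⟨C, hC⟩ := hfbdd R hR0
    obtain ⟨k, hk⟩ := (isCompact_Icc.image_of_continuousOn
      (hKcont.mono (Icc_subset_Ici_self : Icc 0 R ⊆ Ici 0))).bddAbove
    have hk0 : 0 ≤ k := by
      have := hk (mem_image_of_mem K ⟨le_rfl, hR0.le⟩)
      rwa [hKzero] at this
    refine ⟨_, hSle r R M k C hM0 hk0 hM (fun x hx => ?_) ((le_max_left r 1).trans hR) hC⟩
    have hxR := (hnorm x R hR0.le (hx.trans_lt hRγ)).le
    exact ⟨hxR, hk (mem_image_of_mem K ⟨norm_nonneg x, hxR⟩)⟩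
  have hSsmall : ∀ ε > 0, ∃ δ > 0, ∀ b ∈ S δ, b ≤ ε := by
    intro ε hε
    obtain ⟨M, hM0, hM⟩ := hderivBdd (γ 1)
    obtain ⟨C, hC⟩ := hfbdd 1 one_pos
    have hC0 : 0 ≤ C := (norm_nonneg _).trans (hC 0 0 (by simp) (by simp))
    set k : ℝ := ε / 2 / (M * C + 1) with hk
    have hMC : 0 < M * C + 1 := by positivity
    have hk0 : 0 < k := by positivity
    have hMkC : M * (k * C) ≤ ε / 2 := by
      have h1 : k * (M * C + 1) = ε / 2 := div_mul_cancel₀ _ hMC.ne'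
      have h2 : M * (k * C) = k * (M * C + 1) - k := by ring
      linarith
    obtain ⟨η, hη0, hη1, hη⟩ : ∃ η > 0, η ≤ 1 ∧ ∀ r, 0 ≤ r → r < η → K r ≤ k := by
      have h1 : ∀ᶠ r in 𝓝[≥] 0, K r < k := by
        have h2 := hKcont 0 (mem_Ici.2 le_rfl)
        rw [ContinuousWithinAt, hKzero] at h2
        exact h2.eventually (gt_mem_nhds hk0)
      obtain ⟨η, hη0, hη⟩ := mem_nhdsGE_iff_exists_Ico_subset.1 h1
      exact ⟨min η 1, lt_min hη0 one_pos, min_le_right _ _, fun r h0 hr =>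
        (le_of_lt (hη ⟨h0, hr.trans_le (min_le_left _ _)⟩))⟩
    have hψη : 0 < ψ₁ η := by
      have := hψ₁.strictMono (mem_Ici.2 le_rfl) (mem_Ici.2 hη0.le) hη0
      rwa [hψ₁.zero] at this
    have hev : ∀ {β : ℝ → ℝ}, ClassK β → ∀ b > 0, ∀ᶠ r in 𝓝[>] 0, β r < b := by
      intro β hβ b hb
      have h1 := (hβ.cont 0 (mem_Ici.2 le_rfl)).mono Ioi_subset_Ici_self
      rw [ContinuousWithinAt, hβ.zero] at h1
      exact h1.eventually (gt_mem_nhds hb)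
    obtain ⟨δ, ⟨hδψ, hδκ⟩, hδ0, hδ1⟩ := (((hev hγ _ hψη).and
      (hev (hκξ.comp hγ) (ε / 2) (half_pos hε))).and (Ioo_mem_nhdsGT one_pos)).exists
    refine ⟨δ, hδ0, fun b hb => ?_⟩
    have hγδ : γ δ ≤ γ 1 := hγ.monotoneOn (mem_Ici.2 hδ0.le) (mem_Ici.2 zero_le_one) hδ1.le
    have := hSle δ 1 M k C hM0 hk0.le (fun w hw => hM w ⟨hw.1, hw.2.trans hγδ⟩)
      (fun x hx => ?_) hδ1.le hC b hb
    · linarith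
    · have hxη := hnorm x η hη0.le (hx.trans_lt hδψ)
      exact ⟨hxη.le.trans hη1, hη _ (norm_nonneg x) hxη⟩
  obtain ⟨ρ, hρ, hSρ⟩ := exists_classK_bound hSmono hSbdd hSsmall
  refine ⟨ξ, hξ, ⟨hξC1.continuous.comp h.cont, fun r => ξ (ψ₁ r), fun r => ξ (ψ₂ r),
    hξ.toClassKInf.comp hψ₁, hξ.toClassKInf.comp hψ₂, fun x => ⟨?_, ?_⟩⟩, κ, ρ, hκ, hρ, ?_⟩
  · exact hξ.monotoneOn (hψ₁.nonneg (norm_nonneg x)) (hWnonneg x) (hψ x).1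
  · exact hξ.monotoneOn (hWnonneg x) (hψ₂.nonneg (norm_nonneg x)) (hψ x).2
  intro x u hu T φ hφ
  obtain ⟨hφ0, δ, hδ0, hφc, hφd⟩ := hφ.exists_hasDerivWithinAt hf hfcont hu
  obtain ⟨hu0, hd⟩ := hφd 0 ⟨le_rfl, hδ0⟩
  rw [hφ0] at hd
  have hWlim : Tendsto (fun t => W (φ t)) (𝓝[>] 0) (𝓝 (W x)) := by
    have h1 := (hd.mono Ioi_subset_Ici_self).continuousWithinAt.tendsto
    rw [hφ0] at h1
    exact (h.cont.tendsto x).comp h1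
  have hchain : ∀ {d : ℝ}, upperDini W x φ ≤ (d : EReal) →
      upperDini (fun y => ξ (W y)) x φ ≤ ((deriv ξ (W x) * d : ℝ) : EReal) := fun hd' =>
    upperDini_comp_le (hξC1.differentiable one_ne_zero _) (hξpos _) hWlim hd'
  rcases lt_or_ge (γ (inputNorm u)) (W x) with hlt | hge
  · refine (hchain (hdecay x u hu hlt T φ hφ)).trans (EReal.coe_le_coe_iff.2 ?_)
    have h1 := hκα (W x) (hWnonneg x)
    have h2 := hρ.nonneg (inputNorm_nonneg u)
    linarith
  · refine (hchain (upperDini_le_of_continuous_lipschitz hKcont hW hφ0 hd)).trans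
      (EReal.coe_le_coe_iff.2 ?_)
    have h1 := hSρ _ (inputNorm_nonneg u) _ ⟨x, u 0, hge, hu0, rfl⟩
    linarith

end Lyapunov

end InfNet

theorem proposition3
    {E : ℕ → Type*} {F : ℕ → Type*}
    [∀ i, NormedAddCommGroup (E i)] [∀ i, NormedSpace ℝ (E i)]
    [∀ i, FiniteDimensional ℝ (E i)] [∀ i, Nontrivial (E i)]
    [∀ i, NormedAddCommGroup (F i)] [∀ i, NormedSpace ℝ (F i)]
    [∀ i, FiniteDimensional ℝ (F i)] [∀ i, Nontrivial (F i)]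
    -- the network
    (N : InfNet.Network E F) (hsub : N.SubsystemsWellPosed)
    (hwp : N.WellPosed) (hbic : N.BIC)
    -- ISS Lyapunov functions of the subsystems
    (V : ∀ i, E i → ℝ≥0) (hVcont : ∀ i, Continuous (V i))
    (hVdiff : ∀ i, ContDiffOn ℝ 1 (fun z => (V i z : ℝ)) {0}ᶜ)
    (ψl ψr : ℕ → ℝ → ℝ)
    (hψl : ∀ i, InfNet.ClassKInf (ψl i)) (hψr : ∀ i, InfNet.ClassKInf (ψr i))
    (hVcoer : ∀ i (z : E i), ψl i ‖z‖ ≤ V i z ∧ (V i z : ℝ) ≤ ψr i ‖z‖)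
    (μ : ℕ → InfNet.posCone → ℝ≥0∞) (hμ : ∀ i, InfNet.IsMHAF (μ i))
    (γ : ℕ → ℕ →₀ ℝ≥0) (hγ : ∀ i j, j ∉ N.nbr i → γ i j = 0)
    (γu : ℕ → ℝ → ℝ) (hγu : ∀ i, InfNet.ClassK (γu i))
    (α : ℕ → ℝ → ℝ) (hα : ∀ i, InfNet.ClassP (α i))
    (hVdecay : ∀ (i : ℕ) (x : lp E ∞) (u : lp F ∞),
      max (μ i (InfNet.gainRow (γ i) (fun j => V j (x j)))) (ENNReal.ofReal (γu i ‖u i‖))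
          < (V i (x i) : ℝ≥0∞) →
        fderiv ℝ (fun z => (V i z : ℝ)) (x i) (N.rhs x u i) ≤ -α i (V i (x i)))
    -- uniform coercivity bounds
    (ψ₁ ψ₂ : ℝ → ℝ) (hψ₁ : InfNet.ClassKInf ψ₁) (hψ₂ : InfNet.ClassKInf ψ₂)
    (hψ : ∀ i r, 0 ≤ r → ψ₁ r ≤ ψl i r ∧ ψr i r ≤ ψ₂ r)
    -- the gain operator is well-defined, with spectral radius less than one
    (hΓ : InfNet.GainWellDefined μ γ)
    (hrad : ∃ r < 1, InfNet.HasSpectralRadius (InfNet.gainOp μ γ hΓ) r)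
    -- uniform bounds on the external gains and on the decay rates
    (γmax : ℝ → ℝ) (hγmax : InfNet.ClassK γmax) (hγuγmax : ∀ i r, 0 ≤ r → γu i r ≤ γmax r)
    (αt : ℝ → ℝ) (hαt : InfNet.ClassP αt) (hααt : ∀ i r, 0 ≤ r → αt r ≤ α i r)
    -- uniform local Lipschitz condition
    (L : ℝ → ℝ) (hLpos : ∀ R, 0 < R → 0 < L R)
    (hL : ∀ R, 0 < R → ∀ i (y z : E i), ‖y‖ < R → ‖z‖ < R →
      |(V i y : ℝ) - V i z| ≤ L R * ‖y - z‖)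
    -- `f` is a continuous map from `X × U` to `X`, bounded on bounded sets
    (f : lp E ∞ × lp F ∞ → lp E ∞) (hf : ∀ x u i, f (x, u) i = N.rhs x u i)
    (hfcont : Continuous f)
    (hfbdd : ∀ R, 0 < R → ∃ C : ℝ, ∀ x u, ‖x‖ ≤ R → ‖u‖ ≤ R → ‖f (x, u)‖ ≤ C)
    -- additional regularity of the `V i`
    (hVzero : ∀ i, ContDiffAt ℝ 1 (fun z => (V i z : ℝ)) 0)
    (hLcont : ContinuousOn L (Ioi 0)) (hLlim : Tendsto L (𝓝[>] 0) (𝓝 0)) :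
    (∃ s₀ ∈ interior (InfNet.posCone : Set InfNet.EllInf),
      N.IsISSLyapunovImplication (InfNet.supLyapunov V s₀)) ∧
    ∀ s₀ ∈ interior (InfNet.posCone : Set InfNet.EllInf),
      N.IsISSLyapunovImplication (InfNet.supLyapunov V s₀) →
        ∃ ξ : ℝ → ℝ, InfNet.IsNonlinearScaling ξ ∧
          N.IsISSLyapunovDissipative (fun x => ξ (InfNet.supLyapunov V s₀ x)) := by
  have hcomplete : ∀ i, CompleteSpace (E i) := fun i => FiniteDimensional.complete ℝ (E i)
  have hVψ₁ : ∀ i z, ψ₁ ‖z‖ ≤ V i z := fun i z =>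
    (hψ i _ (norm_nonneg z)).1.trans (hVcoer i z).1
  have hVψ₂ : ∀ i z, (V i z : ℝ) ≤ ψ₂ ‖z‖ := fun i z =>
    (hVcoer i z).2.trans (hψ i _ (norm_nonneg z)).2
  constructor
  · obtain ⟨r, hr, hrad⟩ := hrad
    obtain ⟨s, l, hl0, hl1, hs1, hs⟩ := InfNet.exists_decay_point hμ hΓ hr hrad
    have hsn : 1 ≤ ‖(s : InfNet.EllInf)‖ := (hs1 0).trans (InfNet.EllInf.le_norm s.1 0)
    have hVdiff' : ∀ i, Differentiable ℝ fun z => (V i z : ℝ) := by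
      intro i z
      by_cases hz : z = 0
      · rw [hz]
        exact (hVzero i).differentiableAt one_ne_zero
      · exact ((hVdiff i).differentiableOn one_ne_zero).differentiableAt
          (isOpen_compl_singleton.mem_nhds hz)
    have hdecay : ∀ (i : ℕ) (x : lp E ∞) (u : lp F ∞),
        max (μ i (InfNet.gainRow (γ i) (fun j => V j (x j)))) (ENNReal.ofReal (γmax ‖u‖))
            < (V i (x i) : ℝ≥0∞) →
          fderiv ℝ (fun z => (V i z : ℝ)) (x i) (N.rhs x u i) ≤ -αt (V i (x i)) := by
      intro i x u h
      refine (hVdecay i x u (lt_of_le_of_lt (max_le_max le_rfl ?_) h)).trans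
        (neg_le_neg (hααt i _ (V i (x i)).2))
      refine ENNReal.ofReal_le_ofReal ((hγuγmax i _ (norm_nonneg _)).trans ?_)
      exact hγmax.monotoneOn (norm_nonneg _) (norm_nonneg _)
        (lp.norm_apply_le_norm ENNReal.top_ne_zero u i)
    obtain ⟨β, hβ, hβle⟩ := hαt.exists_le_scaled (a := 1 / 2) (b := 2 * ‖(s : InfNet.EllInf)‖)
      (by norm_num) (by linarith)
    refine ⟨s.1, InfNet.mem_interior_posCone one_pos hs1,
      InfNet.isCoerciveCandidate_supLyapunov hψ₁ hψ₂ hVψ₁ hVψ₂ one_pos hs1 hLpos hL,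
      fun r => γmax r / (1 / 2), fun r => β r / ‖(s : InfNet.EllInf)‖,
      hγmax.div_const (by norm_num), ⟨hβ.cont.div_const _, by simp [hβ.zero],
        fun r hr => div_pos (hβ.pos r hr) (by linarith)⟩, fun x u hu hux T φ hφ => ?_⟩
    have hR : 0 < ‖x‖ + 1 := by positivity
    have hx0 := InfNet.supLyapunov_nonneg (V := V) one_pos hs1 x
    exact hφ.upperDini_supLyapunov_le hf hfcont hVdiff' hψ₂.toClassK hVψ₂ hμ hΓ hl0 hl1 hs one_pos
      hs1 hγmax hdecay (hLpos _ hR).le (hL _ hR) (hβ.nonneg hx0) (lt_add_one _)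
      (hβle _ hx0) hu hux
  · intro s₀ hs₀ himp
    obtain ⟨c, hc, hsc⟩ := InfNet.exists_lower_bound_of_mem_interior hs₀
    -- the Lipschitz constant, extended by its limit `0` at the origin
    let K : ℝ → ℝ := fun r => if 0 < r then L r / c else 0
    have hKpos : ∀ r, 0 < r → K r = L r / c := fun r hr => if_pos hr
    have hKzero : K 0 = 0 := if_neg (lt_irrefl 0)
    have hK0 : ∀ r, 0 ≤ r → 0 ≤ K r := by
      intro r hr
      rcases hr.eq_or_lt with rfl | hr
      · exact hKzero.ge
      · rw [hKpos r hr]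
        exact div_nonneg (hLpos r hr).le hc.le
    have hKcont : ContinuousOn K (Ici 0) := by
      intro r hr
      rcases (mem_Ici.1 hr).eq_or_lt with rfl | hr
      · rw [← continuousWithinAt_sdiff_self, Ici_sdiff_left, ContinuousWithinAt, hKzero]
        have h1 := hLlim.div_const c
        rw [zero_div] at h1
        refine h1.congr' ?_
        filter_upwards [self_mem_nhdsWithin] with t ht using (hKpos t ht).symm
      · refine ContinuousAt.continuousWithinAt ?_
        refine ((hLcont.continuousAt (Ioi_mem_nhds hr)).div_const c).congr ?_
        filter_upwards [lt_mem_nhds hr] with t ht using (hKpos t ht).symm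
    refine himp.exists_dissipative hf hfcont hfbdd hK0 hKcont hKzero fun R hR x y hx hy => ?_
    rw [hKpos R hR]
    exact InfNet.abs_supLyapunov_sub_le hψ₂.toClassK hVψ₂ hc hsc (hLpos R hR).le (hL R hR) hx hy
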